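/- Let $k$ be a field with algebraic closure $\bar k$, let $R=k[x_0,\dots,x_n,y_0,\dots,y_m]$ be bigraded by $\deg x_i=(1,0)$, $\deg y_j=(0,1)$, and let $R_X=k[x_0,\dots,x_n]$. Let $I\subseteq R$ be a bihomogeneous ideal and let $(a,b)\in\mathbb Z_{\ge 0}^2$ be an admissible bidegree for $I$ with admissible linear form $h$; that is, $I$ is generated in bidegrees componentwise $\le(a,b)$, and $h\in R_X$ is a linear form such that $$\dim_k (R/I)_{a,b}=\dim_k (R/I)_{a+1,b},\qquad \dim_k (R/(I,h))_{a,b}=0 .$$ Let $M_b=(R/I)_{*,b}=\bigoplus_{a'}(R/I)_{a',b}$, an $R_X$-module, let $J_b=\mathrm{Ann}_{R_X}(M_b)$, and let $\pi_b(V(I))=V(J_b)\subseteq\mathbb P^n(\bar k)$. For $\xi\in\mathbb P^n(\bar k)$ let $\mathfrak p_\xi\subseteq R_X$ be the homogeneous prime ideal generated by the homogeneous polynomials that vanish at $\xi$, and let $M_{b,\xi}=M_b\otimes_{R_X}(R_X)_{\mathfrak p_\xi}$. For $g\in R_X$ homogeneous of degree $j$ let $\bar m_g:(R/I)_{a,b}\to(R/I)_{a+j,b}$,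 $[f]\mapsto[gf]$. Then $\pi_b(V(I))$ is finite, $h$ vanishes at none of its points, and $\bar m_{h^j}$ is bijective for every $j\ge 0$. Moreover there are integers $\mu_\xi>0$, for $\xi\in\pi_b(V(I))$, such that: (1) for every $g'=g/h^j$ in $(R_{X,h})_0$, the degree-zero part of the localization of $R_X$ at the powers of $h$ (with $g$ homogeneous of degree $j$), the characteristic polynomial of the multiplication map $m_{g'}=\bar m_{h^j}^{-1}\circ\bar m_g$ on $(R/I)_{a,b}$ is $$\mathrm{CharPol}_{m_{g'}}(\lambda)=\prod_{\xi\in\pi_b(V(I))}\bigl(\lambda-g'(\xi)\bigr)^{\mu_\xi}\quad\text{in }\bar k[\lambda];$$ (2) $\mu_\xi=\mathrm{length}(M_{b,\xi})$, the length as an $(R_X)_{\mathfrak p_\xi}$-module, for every $\xi\in\pi_b(V(I))$ that has homogeneous coordinates separable over $k$. (If $k$ is perfect, in particular if it is algebraically closed, this is every $\xi\in\pi_b(V(I))$; it also includes every $k$-rational point.) -/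

import Mathlib

open scoped LinearAlgebra.Projectivization

noncomputable section

namespace BihomElim

/-- `R_X = k[x_0, …, x_n]`. -/
abbrev XRing (k : Type*) [Field k] (n : ℕ) : Type _ := MvPolynomial (Fin (n + 1)) k

/-- `R = k[x_0, …, x_n, y_0, …, y_m]`. -/
abbrev BiRing (k : Type*) [Field k] (n m : ℕ) : Type _ :=
  MvPolynomial (Fin (n + 1) ⊕ Fin (m + 1)) k

/-- `R` is an `R_X`-algebra through the inclusion `k[x] ⊆ k[x, y]`. -/
instance instAlgebraXRing (k : Type*) [Field k] (n m : ℕ) : Algebra (XRing k n) (BiRing k n m) :=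
  (MvPolynomial.rename (R := k)
    (Sum.inl : Fin (n + 1) → Fin (n + 1) ⊕ Fin (m + 1))).toRingHom.toAlgebra

lemma algebraMap_eq_rename (k : Type*) [Field k] (n m : ℕ) (f : XRing k n) :
    algebraMap (XRing k n) (BiRing k n m) f = MvPolynomial.rename Sum.inl f := rfl

instance instIsScalarTower (k : Type*) [Field k] (n m : ℕ) :
    IsScalarTower k (XRing k n) (BiRing k n m) :=
  IsScalarTower.of_algebraMap_eq fun c => by
    simp [algebraMap_eq_rename, MvPolynomial.algebraMap_eq]

/-- The bidegrees of the variables: `deg x_i = (1, 0)` and `deg y_j = (0, 1)`. -/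
def biWeight (n m : ℕ) : Fin (n + 1) ⊕ Fin (m + 1) → ℕ × ℕ :=
  Sum.elim (fun _ => (1, 0)) (fun _ => (0, 1))

/-- `R_{a,b}`, the bihomogeneous polynomials of bidegree `(a, b)` (and zero). -/
def biPiece (k : Type*) [Field k] (n m : ℕ) (d : ℕ × ℕ) : Submodule k (BiRing k n m) :=
  MvPolynomial.weightedHomogeneousSubmodule k (biWeight n m) d

variable {k : Type*} [Field k] {n m : ℕ}

/-- `I` is a bihomogeneous ideal. -/
def IsBihomogeneous (I : Ideal (BiRing k n m)) : Prop :=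
  letI := MvPolynomial.weightedGradedAlgebra k (biWeight n m)
  I.IsHomogeneous (MvPolynomial.weightedHomogeneousSubmodule k (biWeight n m))

/-- `I` is generated in bidegrees componentwise at most `(a, b)`. -/
def GeneratedInDegreesLE (I : Ideal (BiRing k n m)) (a b : ℕ) : Prop :=
  ∃ S : Set (BiRing k n m), (∀ f ∈ S, ∃ d : ℕ × ℕ, d ≤ (a, b) ∧ f ∈ biPiece k n m d) ∧
    Ideal.span S = I

/-- `(R/I)_{a,b}`, the image of `R_{a,b}` in `R/I`. -/
def quotPiece (I : Ideal (BiRing k n m)) (a b : ℕ) : Submodule k (BiRing k n m ⧸ I) :=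
  (biPiece k n m (a, b)).map (Ideal.Quotient.mkₐ k I).toLinearMap

lemma degree_of_biWeight (d : Fin (n + 1) ⊕ Fin (m + 1) →₀ ℕ) (a b : ℕ)
    (h : Finsupp.weight (biWeight n m) d = (a, b)) : d.degree = a + b := by
  have key : ∀ e : Fin (n + 1) ⊕ Fin (m + 1) →₀ ℕ,
      e.degree = (Finsupp.weight (biWeight n m) e).1 + (Finsupp.weight (biWeight n m) e).2 := by
    intro e
    induction e using Finsupp.induction_linear with
    | zero => simp
    | add f g hf hg => simp only [map_add, hf, hg, Prod.fst_add, Prod.snd_add]; ring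
    | single i c =>
      rcases i with i | i <;> simp [Finsupp.weight_single, biWeight]
  rw [key d, h]

instance instFinitePiece (I : Ideal (BiRing k n m)) (a b : ℕ) :
    Module.Finite k (quotPiece I a b) := by
  have hle : biPiece k n m (a, b) ≤
      MvPolynomial.restrictTotalDegree (Fin (n + 1) ⊕ Fin (m + 1)) k (a + b) := by
    intro f hf
    rw [MvPolynomial.mem_restrictTotalDegree]
    refine Finset.sup_le fun d hd => ?_
    have h1 := degree_of_biWeight d a b (hf (MvPolynomial.mem_support_iff.mp hd))
    exact h1.le
  have : Module.Finite k (biPiece k n m (a, b)) := Submodule.finiteDimensional_of_le hle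
  exact Module.Finite.map _ _

/-- The Hilbert function `HF_{R/I}(a, b) = dim_k (R/I)_{a,b}`. -/
def hilbertFun (I : Ideal (BiRing k n m)) (a b : ℕ) : ℕ := Module.finrank k (quotPiece I a b)

/-- `(a, b)` is an admissible bidegree for `I`, with admissible linear form `h`. -/
structure IsAdmissible (I : Ideal (BiRing k n m)) (a b : ℕ) (h : XRing k n) : Prop where
  isLinearForm : h.IsHomogeneous 1
  generated : GeneratedInDegreesLE I a b
  hilbertFun_eq : hilbertFun I a b = hilbertFun I (a + 1) b
  hilbertFun_sup : hilbertFun (I ⊔ Ideal.span {algebraMap (XRing k n) (BiRing k n m) h}) a b = 0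

/-- The `R_X`-module `M_b = (R/I)_{*,b} = ⨁_a (R/I)_{a,b}`, realised inside `R/I` as the
`R_X`-submodule generated by (equivalently, the sum of) the pieces `(R/I)_{a,b}`. -/
def rowModule (I : Ideal (BiRing k n m)) (b : ℕ) : Submodule (XRing k n) (BiRing k n m ⧸ I) :=
  Submodule.span (XRing k n) (⋃ a : ℕ, (quotPiece I a b : Set (BiRing k n m ⧸ I)))

/-- The ideal `J_b = Ann_{R_X} ((R/I)_{*,b})`. -/
def rowAnnihilator (I : Ideal (BiRing k n m)) (b : ℕ) : Ideal (XRing k n) :=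
  Module.annihilator (XRing k n) (rowModule I b)

section Points

variable (K : Type*) [Field K] [Algebra k K]

/-- `π_b(V(I)) = V(J_b)`, the set of points of `ℙⁿ(K)` at which all elements of `J_b` vanish. -/
def projB (I : Ideal (BiRing k n m)) (b : ℕ) : Set (ℙ K (Fin (n + 1) → K)) :=
  {ξ | ∀ f ∈ rowAnnihilator I b, MvPolynomial.aeval ξ.rep f = 0}

variable (k) {K}

/-- The homogeneous prime ideal `𝔭_ξ ⊆ R_X` of a point `ξ ∈ ℙⁿ(K)`: the polynomials that vanish
on the whole line `ξ`, i.e. `f (t v) = 0` in `K[t]` where `v` represents `ξ`. -/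
def pointIdeal (ξ : ℙ K (Fin (n + 1) → K)) : Ideal (XRing k n) :=
  RingHom.ker (MvPolynomial.aeval (R := k)
    (fun i => Polynomial.C (ξ.rep i) * Polynomial.X : Fin (n + 1) → Polynomial K))

instance instIsPrimePointIdeal (ξ : ℙ K (Fin (n + 1) → K)) : (pointIdeal k ξ).IsPrime :=
  RingHom.ker_isPrime _

/-- A homogeneous polynomial lies in `𝔭_ξ` exactly when it vanishes at `ξ`. -/
lemma mem_pointIdeal_iff (ξ : ℙ K (Fin (n + 1) → K)) {f : XRing k n} {d : ℕ}
    (hf : f.IsHomogeneous d) : f ∈ pointIdeal k ξ ↔ MvPolynomial.aeval ξ.rep f = 0 := by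
  have key : MvPolynomial.aeval (R := k)
      (fun i => Polynomial.C (ξ.rep i) * Polynomial.X : Fin (n + 1) → Polynomial K) f =
      Polynomial.C (MvPolynomial.aeval ξ.rep f) * Polynomial.X ^ d := by
    rw [MvPolynomial.aeval_def, MvPolynomial.aeval_def, MvPolynomial.eval₂_eq',
      MvPolynomial.eval₂_eq', map_sum, Finset.sum_mul]
    refine Finset.sum_congr rfl fun e he => ?_
    have hd : ∑ i, e i = d := by
      rw [← hf (MvPolynomial.mem_support_iff.mp he), ← Finsupp.degree_eq_sum,
        Finsupp.degree_eq_weight_one]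
      rfl
    simp only [mul_pow, Finset.prod_mul_distrib, Finset.prod_pow_eq_pow_sum, hd, map_mul,
      map_prod, map_pow, Polynomial.algebraMap_apply, mul_assoc]
  rw [pointIdeal, RingHom.mem_ker, key, mul_eq_zero, Polynomial.C_eq_zero, or_iff_left]
  exact pow_ne_zero _ Polynomial.X_ne_zero

/-- `ξ` has homogeneous coordinates that are separable over `k`. -/
def IsSeparablePoint (ξ : ℙ K (Fin (n + 1) → K)) : Prop :=
  ∃ (v : Fin (n + 1) → K) (hv : v ≠ 0), Projectivization.mk K v hv = ξ ∧ ∀ i, IsSeparable k (v i)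

end Points

/-- `(R_{X,h})_0`, the degree-zero part of the localization of `R_X` at the powers of `h`. -/
abbrev FracRing (h : XRing k n) : Type _ :=
  HomogeneousLocalization.Away (MvPolynomial.homogeneousSubmodule (Fin (n + 1)) k) h

/-- `g' = g / h ^ j` in `(R_{X,h})_0`. -/
def IsFraction {h : XRing k n} (g' : FracRing h) (g : XRing k n) (j : ℕ) : Prop :=
  g'.val = Localization.mk g (⟨h ^ j, j, rfl⟩ : Submonoid.powers h)

/-- The value `g'(ξ)` of `g' ∈ (R_{X,h})_0` at a point `ξ` with `h(ξ) ≠ 0`. -/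
def fracEval {K : Type*} [Field K] [Algebra k K] {h : XRing k n} (g' : FracRing h)
    (ξ : ℙ K (Fin (n + 1) → K)) : K :=
  MvPolynomial.aeval ξ.rep g'.num / MvPolynomial.aeval ξ.rep g'.den

lemma weight_mapDomain_inl (u : Fin (n + 1) →₀ ℕ) :
    Finsupp.weight (biWeight n m) (u.mapDomain Sum.inl) = (u.degree, 0) := by
  induction u using Finsupp.induction_linear with
  | zero => simp; rfl
  | add f g hf hg => simp [Finsupp.mapDomain_add, map_add, hf, hg]
  | single i c => simp [Finsupp.mapDomain_single, Finsupp.weight_single, biWeight]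

lemma mul_mem_quotPiece (I : Ideal (BiRing k n m)) (a b : ℕ) {j : ℕ} {g : XRing k n}
    (hg : g.IsHomogeneous j) (q : BiRing k n m ⧸ I) (hq : q ∈ quotPiece I a b) :
    LinearMap.mulLeft k (Ideal.Quotient.mk I (algebraMap (XRing k n) (BiRing k n m) g)) q ∈
      quotPiece I (a + j) b := by
  obtain ⟨f, hf, rfl⟩ := hq
  refine ⟨algebraMap (XRing k n) (BiRing k n m) g * f, ?_, ?_⟩
  · have h1 : MvPolynomial.IsWeightedHomogeneous (biWeight n m)
        (algebraMap (XRing k n) (BiRing k n m) g) (j, 0) := by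
      intro d hd
      rw [algebraMap_eq_rename] at hd
      obtain ⟨u, rfl, hu⟩ := MvPolynomial.coeff_rename_ne_zero _ _ _ hd
      have hu' : u.degree = j := by
        rw [← hg hu, Finsupp.degree_eq_weight_one]
        rfl
      rw [weight_mapDomain_inl, hu']
    have h2 := h1.mul hf
    rw [Prod.mk_add_mk, zero_add, add_comm j a] at h2
    exact h2
  · simp

/-- For `g ∈ R_X` homogeneous of degree `j`, the multiplication map
`(R/I)_{a,b} → (R/I)_{a+j,b}`, `[f] ↦ [g f]`. -/
def mulBar (I : Ideal (BiRing k n m)) (a b : ℕ) {j : ℕ} {g : XRing k n}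
    (hg : g.IsHomogeneous j) : quotPiece I a b →ₗ[k] quotPiece I (a + j) b :=
  (LinearMap.mulLeft k (Ideal.Quotient.mk I (algebraMap (XRing k n) (BiRing k n m) g))).restrict
    (mul_mem_quotPiece I a b hg)

/-- If multiplication by `p` is bijective (`p` and `g` homogeneous of degree `j`), the endomorphism
`m_{g/p} = (mulBar p)⁻¹ ∘ mulBar g` of `(R/I)_{a,b}`. -/
def fracMul (I : Ideal (BiRing k n m)) (a b : ℕ) {j : ℕ} {p g : XRing k n}
    (hp : p.IsHomogeneous j) (hinv : Function.Bijective (mulBar I a b hp))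
    (hg : g.IsHomogeneous j) : Module.End k (quotPiece I a b) :=
  (LinearEquiv.ofBijective (mulBar I a b hp) hinv).symm.toLinearMap ∘ₗ mulBar I a b hg

lemma IsAdmissible.pow_isHomogeneous {I : Ideal (BiRing k n m)} {a b : ℕ} {h : XRing k n}
    (hadm : IsAdmissible I a b h) (j : ℕ) : (h ^ j).IsHomogeneous j := by
  simpa using hadm.isLinearForm.pow j

end BihomElim

end

/-!
# Eigenvalues of multiplication maps and the projection of a bihomogeneous zero set

Write `V = (R/I)_{a,b}` and `M = (R/I)_{*,b}`.

**The operators.** The vanishing of `(R/(I, h))_{a,b}` says that every element of `V` is a multiple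
`h w`, and together with the equality of Hilbert functions that `h : (R/I)_{a,b} → (R/I)_{a+1,b}` is
bijective. So `x_i` acts on `V` as `h⁻¹ x_i`. These operators commute, because on `h w` the operator
is `x_i w`, so that both composites with `x_j` become `x_i x_j w` after multiplication by `h`
(`exists_operators`). Hence `V` is a `k[x]`-module on which `h` acts as the identity. Freeness of
`k[x, y]` over `k[x]` gives a `k[x]`-linear map `R → V` sending `y ^ β` to `[h ^ a y ^ β]`; it
kills `I`, because `I` is generated in bidegrees `≤ (a, b)`, and is the quotient map on `R_{a,b}`
(`exists_retraction`). Its existence makes multiplication by `h ^ j` injective on `V` for all `j`,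
and identifies `g / h ^ j` on `V` with the action of `g`.

**The points.** For a finite-dimensional `k[x]`-module with `h = 1` the joint eigenvalues of the
`x_i` form a multiset computing all characteristic polynomials (`exists_isPointMultiset`). Both
sides are additive in exact sequences, so it is enough to treat simple modules, that is, finite
extensions `L` of `k`; there the points correspond to the embeddings of `L`, each with multiplicity
the inseparable degree of `L` (`charpoly_lmul_map_eq_prod_embeddings`), which is `1` when the
coordinates are separable.

**The lengths.** Passing from `V` back to the graded module `M` amounts to forming `V[t]` with `x_i`
acting as `x_i t` (`GradedExt`): sending an element of degree `d` to its image in `V` times `t ^ d`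
defines a map `M → V[t]` whose kernel and cokernel are killed by `h ^ a`, so `M` and `V[t]` agree
after localization at primes not containing `h`. The length of the localization of `V[t]` is again
additive, and is `1` or `0` for a simple module.

**The support.** The same comparison matches zeros of `Ann M` at which `h ≠ 0` with zeros of `Ann V`.
No zero of `Ann M` lies on `h = 0`: multiplication by `x_i ^ a` maps `M` into `h M`, and the
determinant trick puts into `Ann M` a polynomial monic in `x_i ^ a` modulo `h`
(`aeval_rep_ne_zero`).
-/

/-! ### Characteristic polynomials in exact sequences and field extensions -/

namespace BihomElim

open Polynomial Module

section Charpoly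

variable {F A B C : Type*} [Field F] [AddCommGroup A] [AddCommGroup B] [AddCommGroup C]
  [Module F A] [Module F B] [Module F C] [FiniteDimensional F B]

open Module.Basis in
theorem charpoly_eq_restrict_mul_mapQ (W : Submodule F B) (e : B →ₗ[F] B) (he : W ≤ W.comap e) :
    e.charpoly = (e.restrict he).charpoly * (W.mapQ W e he).charpoly := by
  classical
  let bW := Module.Free.chooseBasis F W
  let bQ := Module.Free.chooseBasis F (B ⧸ W)
  let b := sumQuot bW bQ
  suffices LinearMap.toMatrix b b e = Matrix.fromBlocks (LinearMap.toMatrix bW bW (e.restrict he))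
      (Matrix.of fun i l ↦ (b.repr (e (b (Sum.inr l)))) (Sum.inl i)) 0
      (LinearMap.toMatrix bQ bQ (W.mapQ W e he)) by
    rw [← LinearMap.charpoly_toMatrix e b, this, ← LinearMap.charpoly_toMatrix _ bW,
      ← LinearMap.charpoly_toMatrix _ bQ, Matrix.charpoly_fromBlocks_zero₂₁]
  ext u v
  cases u with
  | inl i =>
    cases v with
    | inl k =>
      simp only [b, sumQuot_inl, Matrix.fromBlocks_apply₁₁, LinearMap.toMatrix_apply]
      apply sumQuot_repr_inl_of_mem
    | inr l => simp [b, LinearMap.toMatrix_apply, Matrix.fromBlocks_apply₁₂]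
  | inr j =>
    cases v with
    | inl k =>
      suffices W.mkQ (e (bW k)) = 0 by simp [LinearMap.toMatrix_apply, b, this]
      rw [← LinearMap.mem_ker, Submodule.ker_mkQ]
      exact he (Submodule.coe_mem (bW k))
    | inr l =>
      simp only [LinearMap.toMatrix_apply, sumQuot_repr_inr, Matrix.fromBlocks_apply₂₂, b]
      rw [← sumQuot_inr bW bQ l, W.mapQ_apply]
      simp

/-- The characteristic polynomial is multiplicative along short exact sequences. -/
theorem charpoly_eq_mul_of_exact [FiniteDimensional F A] [FiniteDimensional F C]
    {i : A →ₗ[F] B} {p : B →ₗ[F] C} (hi : Function.Injective i)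
    (hp : Function.Surjective p) (hip : Function.Exact i p)
    {a : End F A} {b : End F B} {c : End F C} (hab : b ∘ₗ i = i ∘ₗ a) (hbc : c ∘ₗ p = p ∘ₗ b) :
    b.charpoly = a.charpoly * c.charpoly := by
  have he : LinearMap.range i ≤ (LinearMap.range i).comap b := by
    rintro _ ⟨x, rfl⟩
    exact ⟨a x, (LinearMap.congr_fun hab x).symm⟩
  rw [charpoly_eq_restrict_mul_mapQ _ b he]
  congr 1
  · let e := LinearEquiv.ofInjective i hi
    rw [← LinearEquiv.charpoly_conj e a]
    congr 1
    ext y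
    obtain ⟨x, rfl⟩ := e.surjective y
    rw [LinearEquiv.conj_apply_apply, LinearEquiv.symm_apply_apply]
    exact LinearMap.congr_fun hab x
  · let e : (B ⧸ LinearMap.range i) ≃ₗ[F] C :=
      (Submodule.quotEquivOfEq _ _ (LinearMap.exact_iff.mp hip).symm).trans
        (p.quotKerEquivOfSurjective hp)
    rw [← LinearEquiv.charpoly_conj e]
    congr 1
    ext y
    obtain ⟨x, rfl⟩ := hp y
    have hx : e.symm (p x) = Submodule.Quotient.mk x := by
      rw [LinearEquiv.symm_apply_eq]; rfl
    rw [LinearEquiv.conj_apply_apply, hx]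
    exact (LinearMap.congr_fun hbc x).symm

end Charpoly

section FieldExtension

variable (k L E : Type*) [Field k] [Field L] [Field E] [Algebra k L] [Algebra k E]
  [FiniteDimensional k L] [IsAlgClosed E]

open IntermediateField

variable {L} in
/-- In a basis of `L` over `k` adapted to `k(x)`, multiplication by `x` is block diagonal with the
companion matrix of `minpoly k x` in every block. -/
theorem charpoly_lmul_eq_minpoly_pow (x : L) :
    (Algebra.lmul k L x).charpoly = minpoly k x ^ finrank k⟮x⟯ L := by
  classical
  have hx := Algebra.IsIntegral.isIntegral (R := k) x
  let pb := adjoin.powerBasis hx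
  let c := Module.finBasis k⟮x⟯ L
  have h1 : (Algebra.lmul k L x).charpoly =
      (Algebra.leftMulMatrix (pb.basis.smulTower c) (algebraMap k⟮x⟯ L pb.gen)).charpoly := by
    rw [← LinearMap.charpoly_toMatrix _ (pb.basis.smulTower c)]
    simp [pb, Algebra.leftMulMatrix]
  rw [h1, Algebra.smulTower_leftMulMatrix_algebraMap]
  have h2 : Matrix.charmatrix (Matrix.blockDiagonal fun _ : Fin (finrank k⟮x⟯ L) =>
      Algebra.leftMulMatrix pb.basis pb.gen) = Matrix.blockDiagonal fun _ =>
        Matrix.charmatrix (Algebra.leftMulMatrix pb.basis pb.gen) := by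
    ext1 ⟨i, j⟩ ⟨i', j'⟩
    by_cases h : j = j' <;> by_cases h' : i = i' <;>
      simp [Matrix.blockDiagonal_apply, h, h']
  rw [Matrix.charpoly, h2, Matrix.det_blockDiagonal, Finset.prod_const, Finset.card_univ,
    Fintype.card_fin]
  congr 1
  have := charpoly_leftMulMatrix pb
  rw [Matrix.charpoly] at this
  rw [this, adjoin.powerBasis_gen, minpoly_gen]

/-- All roots of an irreducible polynomial have the same multiplicity, which is a power `p ^ n` of
the exponential characteristic: the polynomial is `g(X ^ (p ^ n))` with `g` separable. -/
theorem exists_map_eq_prod_aroots_pow {f : k[X]} (hf : Irreducible f) (hm : f.Monic) :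
    letI := Classical.decEq E
    ∃ q : ℕ, f.map (algebraMap k E) = (∏ θ ∈ (f.aroots E).toFinset, (X - C θ)) ^ q := by
  classical
  obtain ⟨p, _⟩ := ExpChar.exists k
  have : ExpChar E p := expChar_of_injective_algebraMap (algebraMap k E).injective p
  obtain ⟨g, hg, n, hgf⟩ := hf.hasSeparableContraction p
  refine ⟨p ^ n, ?_⟩
  have hsp := (IsAlgClosed.splits (f.map (algebraMap k E))).eq_prod_roots_of_monic (hm.map _)
  have hroots : f.aroots E = p ^ n •
      ((g.map (algebraMap k E)).roots.map (iterateFrobeniusEquiv E p n).symm) := by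
    rw [← Polynomial.roots_expand_pow, ← Polynomial.map_expand, hgf]
  have hnd : ((g.map (algebraMap k E)).roots.map (iterateFrobeniusEquiv E p n).symm).Nodup :=
    (Polynomial.nodup_roots hg.map).map (RingEquiv.injective _)
  have hp : p ^ n ≠ 0 := pow_ne_zero _ (expChar_pos k p).ne'
  rw [hsp]
  change (((f.aroots E)).map _).prod = _
  rw [hroots, Multiset.toFinset_nsmul _ _ hp, Multiset.map_nsmul, Multiset.prod_nsmul,
    Finset.prod_multiset_map_count]
  congr 1
  refine Finset.prod_congr rfl fun θ hθ => ?_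
  rw [Multiset.count_eq_one_of_mem hnd (Multiset.mem_toFinset.mp hθ), pow_one]

variable {L} in
/-- Each root of the minimal polynomial of `x` is the image of `x` under the same number of
embeddings, namely the separable degree of `L` over `k(x)`. -/
theorem prod_embeddings_eq_prod_aroots_pow (x : L) :
    letI := Classical.decEq E
    ∃ q : ℕ, ∏ σ : L →ₐ[k] E, (X - C (σ x)) =
      (∏ θ ∈ ((minpoly k x).aroots E).toFinset, (X - C θ)) ^ q := by
  classical
  have hx := Algebra.IsIntegral.isIntegral (R := k) x
  have hmem : ∀ σ : L →ₐ[k] E, σ x ∈ ((minpoly k x).aroots E).toFinset := fun σ => by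
    rw [Multiset.mem_toFinset, Polynomial.mem_aroots]
    exact ⟨minpoly.ne_zero hx, by rw [Polynomial.aeval_algHom_apply, minpoly.aeval, map_zero]⟩
  refine ⟨Field.finSepDegree k⟮x⟯ L, ?_⟩
  rw [← Finset.prod_fiberwise_of_maps_to (s := Finset.univ) (g := fun σ : L →ₐ[k] E => σ x)
    (fun σ _ => hmem σ), ← Finset.prod_pow]
  refine Finset.prod_congr rfl fun θ hθ => ?_
  rw [Finset.prod_congr rfl (g := fun _ => X - C θ)
    (fun σ hσ => by rw [(Finset.mem_filter.mp hσ).2]), Finset.prod_const]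
  congr 1
  have hroot : aeval θ (minpoly k x) = 0 :=
    (Polynomial.mem_aroots.mp (Multiset.mem_toFinset.mp hθ)).2
  -- embeddings `σ` with `σ x = θ` are those over `k(x)`, when `E` is a `k(x)`-algebra via `x ↦ θ`
  let φ : k⟮x⟯ →ₐ[k] E := (algHomAdjoinIntegralEquiv k hx).symm ⟨θ, by
    simpa using Multiset.mem_toFinset.mp hθ⟩
  have hφ : φ (AdjoinSimple.gen k x) = θ := algHomAdjoinIntegralEquiv_symm_apply_gen k hx _
  let _ : Algebra k⟮x⟯ E := φ.toRingHom.toAlgebra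
  have : IsScalarTower k k⟮x⟯ E := IsScalarTower.of_algebraMap_eq fun c => (φ.commutes c).symm
  rw [Field.finSepDegree_eq_of_isAlgClosed k⟮x⟯ L E, ← Nat.card_eq_finsetCard]
  refine Nat.card_congr
    { toFun := fun σ => { σ.1 with
        commutes' := fun c => ?_ }
      invFun := fun τ => ⟨τ.restrictScalars k, ?_⟩
      left_inv := fun σ => by ext; rfl
      right_inv := fun τ => by ext; rfl }
  · have : (σ.1.comp (IsScalarTower.toAlgHom k k⟮x⟯ L)) = φ := by
      apply (adjoin.powerBasis hx).algHom_ext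
      rw [adjoin.powerBasis_gen, hφ]
      have := (Finset.mem_filter.mp σ.2).2
      simpa using this
    exact DFunLike.congr_fun this c
  · rw [Finset.mem_filter]
    refine ⟨Finset.mem_univ _, ?_⟩
    have := τ.commutes (AdjoinSimple.gen k x)
    rw [show algebraMap k⟮x⟯ E (AdjoinSimple.gen k x) = θ from hφ] at this
    simpa using this

variable {L} in
/-- Over an algebraically closed field the characteristic polynomial of an element of a finite
extension splits into the images of the element under the embeddings, each counted with the
inseparable degree. -/
theorem charpoly_lmul_map_eq_prod_embeddings (x : L) :
    (Algebra.lmul k L x).charpoly.map (algebraMap k E) =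
      (∏ σ : L →ₐ[k] E, (X - C (σ x))) ^ Field.finInsepDegree k L := by
  classical
  have hx := Algebra.IsIntegral.isIntegral (R := k) x
  obtain ⟨q, hq⟩ := exists_map_eq_prod_aroots_pow k E (minpoly.irreducible hx) (minpoly.monic hx)
  obtain ⟨r, hr⟩ := prod_embeddings_eq_prod_aroots_pow k E x
  -- both sides are powers of the product over the distinct roots of `minpoly k x`, so it is enough to
  -- compare degrees
  have hdeg : ((Algebra.lmul k L x).charpoly.map (algebraMap k E)).natDegree =
      ((∏ σ : L →ₐ[k] E, (X - C (σ x))) ^ Field.finInsepDegree k L).natDegree := by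
    rw [Polynomial.natDegree_map, LinearMap.charpoly_natDegree, Polynomial.natDegree_pow,
      Polynomial.natDegree_prod_of_monic _ _ fun σ _ => monic_X_sub_C _]
    simp only [natDegree_X_sub_C, Finset.sum_const, Finset.card_univ, smul_eq_mul, mul_one]
    rw [← Nat.card_eq_fintype_card, ← Field.finSepDegree_eq_of_isAlgClosed k L E, mul_comm,
      Field.finSepDegree_mul_finInsepDegree]
  have hpos : 0 < (∏ θ ∈ ((minpoly k x).aroots E).toFinset, (X - C θ)).natDegree := by
    refine Nat.pos_of_ne_zero fun h0 => (minpoly.natDegree_pos hx).ne' ?_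
    rw [← Polynomial.natDegree_map (algebraMap k E), hq, natDegree_pow, h0, mul_zero]
  rw [charpoly_lmul_eq_minpoly_pow, Polynomial.map_pow, hq, hr, ← pow_mul, ← pow_mul] at hdeg ⊢
  rw [natDegree_pow, natDegree_pow] at hdeg
  rw [Nat.eq_of_mul_eq_mul_right hpos hdeg]

end FieldExtension

end BihomElim

/-! ### Lengths of localized modules and the graded extension of a module -/

namespace BihomElim

open Module

section LocalizedLength

variable {A M N P : Type*} [CommRing A] [AddCommGroup M] [AddCommGroup N] [AddCommGroup P]
  [Module A M] [Module A N] [Module A P] (S : Submonoid A)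

theorem localizedModule_mk_eq_zero_iff {S : Submonoid A} {x : M} {t : S} :
    LocalizedModule.mk x t = 0 ↔ ∃ u : S, u • x = 0 := by
  rw [← LocalizedModule.zero_mk 1, LocalizedModule.mk_eq]
  simp only [one_smul, smul_zero]

/-- A map whose kernel and cokernel are `S`-torsion becomes an isomorphism after localization. -/
theorem length_localizedModule_eq_of_torsion (f : M →ₗ[A] N)
    (hker : ∀ x, f x = 0 → ∃ s ∈ S, s • x = 0) (hcoker : ∀ y, ∃ s ∈ S, ∃ x, f x = s • y) :
    Module.length (Localization S) (LocalizedModule S M) =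
      Module.length (Localization S) (LocalizedModule S N) := by
  refine (LinearEquiv.ofBijective (LocalizedModule.map S f) ⟨?_, ?_⟩).length_eq
  · rw [injective_iff_map_eq_zero]
    intro z hz
    induction z using LocalizedModule.induction_on with
    | _ x t =>
      rw [LocalizedModule.map_mk, localizedModule_mk_eq_zero_iff] at hz
      obtain ⟨u, hu⟩ := hz
      rw [Submonoid.smul_def, ← map_smul] at hu
      obtain ⟨s, hs, hsx⟩ := hker _ hu
      rw [localizedModule_mk_eq_zero_iff]
      refine ⟨⟨s, hs⟩ * u, ?_⟩
      rw [mul_smul]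
      exact hsx
  · intro z
    induction z using LocalizedModule.induction_on with
    | _ y t =>
      obtain ⟨s, hs, x, hx⟩ := hcoker y
      refine ⟨LocalizedModule.mk x (⟨s, hs⟩ * t), ?_⟩
      rw [LocalizedModule.map_mk, hx]
      exact LocalizedModule.mk_cancel_common_left ⟨s, hs⟩ t y

theorem length_localizedModule_eq_zero (h : ∀ x : M, ∃ s ∈ S, s • x = 0) :
    Module.length (Localization S) (LocalizedModule S M) = 0 := by
  rw [Module.length_eq_zero_iff]
  refine subsingleton_of_forall_eq 0 fun z => ?_
  induction z using LocalizedModule.induction_on with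
  | _ x t =>
    obtain ⟨s, hs, hx⟩ := h x
    exact localizedModule_mk_eq_zero_iff.mpr ⟨⟨s, hs⟩, hx⟩

theorem length_localizedModule_add {i : M →ₗ[A] N} {p : N →ₗ[A] P} (hi : Function.Injective i)
    (hp : Function.Surjective p) (hip : Function.Exact i p) :
    Module.length (Localization S) (LocalizedModule S N) =
      Module.length (Localization S) (LocalizedModule S M) +
        Module.length (Localization S) (LocalizedModule S P) :=
  Module.length_eq_add_of_exact (LocalizedModule.map S i) (LocalizedModule.map S p)
    (LocalizedModule.map_injective S i hi) (LocalizedModule.map_surjective S p hp)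
    (LocalizedModule.map_exact S i p hip)

/-- If `x₀` has annihilator `p` and generates `M` up to `p`-torsion, then `M` localized at `p` is
the residue field of `p`. -/
theorem length_localizedModule_eq_one (p : Ideal A) [p.IsPrime] (x₀ : M)
    (hann : ∀ f : A, f • x₀ = 0 ↔ f ∈ p)
    (hgen : ∀ x : M, ∃ s ∈ p.primeCompl, ∃ f : A, s • x = f • x₀) :
    Module.length (Localization.AtPrime p) (LocalizedModule p.primeCompl M) = 1 := by
  rw [Module.length_eq_one_iff, isSimpleModule_iff_toSpanSingleton_surjective]
  constructor
  · refine ⟨LocalizedModule.mk x₀ 1, 0, fun h0 => ?_⟩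
    obtain ⟨u, hu⟩ := localizedModule_mk_eq_zero_iff.mp h0
    exact u.2 ((hann _).mp hu)
  · intro z hz w
    induction z using LocalizedModule.induction_on with
    | _ x t =>
    induction w using LocalizedModule.induction_on with
    | _ y u =>
    obtain ⟨s, hs, f, hf⟩ := hgen x
    obtain ⟨s', hs', f', hf'⟩ := hgen y
    have hfp : f ∈ p.primeCompl := fun hmem => hz <| by
      exact localizedModule_mk_eq_zero_iff.mpr ⟨⟨s, hs⟩, hf.trans ((hann f).mpr hmem)⟩
    refine ⟨Localization.mk (f' * s * t) (⟨f, hfp⟩ * ⟨s', hs'⟩ * u), ?_⟩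
    rw [LinearMap.toSpanSingleton_apply, LocalizedModule.mk_smul_mk, LocalizedModule.mk_eq]
    refine ⟨1, ?_⟩
    rw [one_smul, one_smul]
    simp only [Submonoid.smul_def, Submonoid.coe_mul, smul_smul]
    have e1 : (u : A) * (f' * s * t) = ((u : A) * f' * t) * s := by ring
    have e2 : f * s' * u * t * t = (f * u * t * t) * s' := by ring
    have e3 : (f * s' * u * t : A) = (f * u * t) * s' := by ring
    rw [e1, mul_smul _ s x, hf, e3, mul_smul _ s' y, hf', smul_smul, smul_smul]
    congr 1
    ring

end LocalizedLength

theorem pow_smul_eq_self {M X : Type*} [Monoid M] [MulAction M X] {s : M} {x : X} (hx : s • x = x)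
    (j : ℕ) : s ^ j • x = x := by
  induction j with
  | zero => rw [pow_zero, one_smul]
  | succ j ih => rw [pow_succ, mul_smul, hx, ih]

section Homogenize

variable {k ι : Type*} [Field k]

open MvPolynomial in
/-- Homogenization with respect to a linear form `h`, up to multiples of `h - 1`. -/
theorem exists_isHomogeneous_sub_dvd {h : MvPolynomial ι k} (hh : h.IsHomogeneous 1)
    (f : MvPolynomial ι k) :
    ∃ (d : ℕ) (g : MvPolynomial ι k), g.IsHomogeneous d ∧ h - 1 ∣ g - f := by
  refine ⟨f.totalDegree, ∑ i ∈ Finset.range (f.totalDegree + 1),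
    h ^ (f.totalDegree - i) * homogeneousComponent i f, ?_, ?_⟩
  · refine IsHomogeneous.sum _ _ _ fun i hi => ?_
    have h1 := (hh.pow (f.totalDegree - i)).mul (homogeneousComponent_isHomogeneous i f)
    have h2 : 1 * (f.totalDegree - i) + i = f.totalDegree := by
      have := Finset.mem_range.mp hi
      omega
    rwa [h2] at h1
  · nth_rewrite 4 [← sum_homogeneousComponent f]
    rw [← Finset.sum_sub_distrib]
    refine Finset.dvd_sum fun i _ => ?_
    rw [← sub_one_mul]
    exact Dvd.dvd.mul_right (by simpa using sub_dvd_pow_sub_pow h 1 (f.totalDegree - i)) _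

/-- The `k`-algebra map `k[x] → k[x][t]`, `x_i ↦ x_i t`, which records degrees: the coefficient of
`t ^ d` in the image of `f` is the homogeneous component of `f` of degree `d`. -/
noncomputable def degreeMark (k ι : Type*) [Field k] :
    MvPolynomial ι k →ₐ[k] Polynomial (MvPolynomial ι k) :=
  MvPolynomial.aeval fun i => Polynomial.C (MvPolynomial.X i) * Polynomial.X

theorem degreeMark_of_isHomogeneous {f : MvPolynomial ι k} {d : ℕ} (hf : f.IsHomogeneous d) :
    degreeMark k ι f = Polynomial.monomial d f := by
  rw [← Polynomial.C_mul_X_pow_eq_monomial]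
  nth_rewrite 2 [← MvPolynomial.aeval_X_left_apply (R := k) f]
  rw [degreeMark, MvPolynomial.aeval_def, MvPolynomial.aeval_def, MvPolynomial.eval₂_eq,
    MvPolynomial.eval₂_eq, map_sum, Finset.sum_mul]
  refine Finset.sum_congr rfl fun e he => ?_
  have hd : ∑ i ∈ e.support, e i = d := by
    rw [← hf (MvPolynomial.mem_support_iff.mp he), Finsupp.weight_apply, Finsupp.sum]
    simp
  simp only [mul_pow, Finset.prod_mul_distrib, Finset.prod_pow_eq_pow_sum, hd, map_mul,
    map_prod, map_pow, Polynomial.algebraMap_apply, mul_assoc]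

theorem coeff_degreeMark (f : MvPolynomial ι k) (d : ℕ) :
    (degreeMark k ι f).coeff d = MvPolynomial.homogeneousComponent d f := by
  nth_rewrite 1 [← MvPolynomial.sum_homogeneousComponent f]
  rw [map_sum, Polynomial.finsetSum_coeff]
  simp only [degreeMark_of_isHomogeneous (MvPolynomial.homogeneousComponent_isHomogeneous _ f),
    Polynomial.coeff_monomial]
  rw [Finset.sum_ite_eq' (Finset.range (f.totalDegree + 1)) d, ite_eq_left_iff]
  intro hd
  rw [Finset.mem_range, not_lt] at hd
  exact (MvPolynomial.homogeneousComponent_eq_zero d f hd).symm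

/-- A polynomial vanishes on the line through `v` exactly when its homogeneous components vanish at
`v`. -/
theorem aeval_C_mul_X_eq_zero_iff {K : Type*} [Field K] [Algebra k K] (v : ι → K)
    (f : MvPolynomial ι k) :
    MvPolynomial.aeval (fun i => Polynomial.C (v i) * Polynomial.X : ι → Polynomial K) f = 0 ↔
      ∀ d, MvPolynomial.aeval v (MvPolynomial.homogeneousComponent d f) = 0 := by
  have h1 : (Polynomial.mapAlgHom (MvPolynomial.aeval v)).comp (degreeMark k ι) =
      MvPolynomial.aeval (fun i => Polynomial.C (v i) * Polynomial.X : ι → Polynomial K) := by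
    ext1 i
    simp [degreeMark]
  rw [← h1, AlgHom.comp_apply, Polynomial.ext_iff]
  refine forall_congr' fun d => ?_
  simp [Polynomial.coeff_map, coeff_degreeMark]

end Homogenize

section GradedExt

variable (k ι : Type*) [Field k] (W W' : Type*) [AddCommGroup W] [Module (MvPolynomial ι k) W]
  [AddCommGroup W'] [Module (MvPolynomial ι k) W']

/-- The polynomials `W[t]` with coefficients in a `k[x]`-module `W`, with the `k[x]`-module
structure in which `x_i` acts as `x_i t`. -/
def GradedExt : Type _ := PolynomialModule (MvPolynomial ι k) W

namespace GradedExt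

noncomputable instance : AddCommGroup (GradedExt k ι W) :=
  inferInstanceAs (AddCommGroup (PolynomialModule (MvPolynomial ι k) W))

noncomputable instance : Module (MvPolynomial ι k) (GradedExt k ι W) :=
  Module.compHom (PolynomialModule (MvPolynomial ι k) W) (degreeMark k ι).toRingHom

variable {W W'}

/-- The coefficients of an element of `W[t]`. -/
def coeff (x : GradedExt k ι W) : ℕ →₀ W := PolynomialModule.coeff x

/-- The element `w t ^ d` of `W[t]`. -/
noncomputable def single (d : ℕ) (w : W) : GradedExt k ι W :=
  PolynomialModule.single (MvPolynomial ι k) d w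

variable {k ι}

theorem ext_coeff {x y : GradedExt k ι W} (h : ∀ d, x.coeff k ι d = y.coeff k ι d) : x = y :=
  PolynomialModule.ext (Finsupp.ext h)

@[simp]
theorem coeff_zero (d : ℕ) : (0 : GradedExt k ι W).coeff k ι d = 0 := rfl

@[simp]
theorem coeff_add (x y : GradedExt k ι W) (d : ℕ) :
    (x + y).coeff k ι d = x.coeff k ι d + y.coeff k ι d := rfl

theorem coeff_single (i : ℕ) (w : W) (d : ℕ) :
    (single k ι i w).coeff k ι d = if i = d then w else 0 :=
  Finsupp.single_apply

theorem coeff_smul_single (f : MvPolynomial ι k) (i : ℕ) (w : W) (d : ℕ) :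
    (f • single k ι i w).coeff k ι d =
      if i ≤ d then MvPolynomial.homogeneousComponent (d - i) f • w else 0 := by
  have h1 : (f • single k ι i w).coeff k ι d = _ :=
    PolynomialModule.smul_single_apply i (degreeMark k ι f) w d
  rw [h1, coeff_degreeMark]

theorem smul_single_of_isHomogeneous {f : MvPolynomial ι k} {e : ℕ} (hf : f.IsHomogeneous e)
    (i : ℕ) (w : W) : f • single k ι i w = single k ι (e + i) (f • w) := by
  have h1 : f • single k ι i w =
    (degreeMark k ι f • PolynomialModule.single (MvPolynomial ι k) i w : PolynomialModule _ W) := rfl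
  rw [h1, degreeMark_of_isHomogeneous hf, PolynomialModule.monomial_smul_single]
  rfl

theorem coeff_smul_of_isHomogeneous {f : MvPolynomial ι k} {e : ℕ} (hf : f.IsHomogeneous e)
    (x : GradedExt k ι W) (d : ℕ) :
    (f • x).coeff k ι d = if e ≤ d then f • x.coeff k ι (d - e) else 0 := by
  let x' : PolynomialModule (MvPolynomial ι k) W := x
  have h1 : (f • x).coeff k ι d = (degreeMark k ι f • x').coeff d := rfl
  rw [h1, degreeMark_of_isHomogeneous hf, PolynomialModule.monomial_smul_apply]
  rfl

theorem induction_single {p : GradedExt k ι W → Prop} (x : GradedExt k ι W) (zero : p 0)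
    (add : ∀ x y, p x → p y → p (x + y)) (single : ∀ d w, p (single k ι d w)) : p x :=
  PolynomialModule.induction_linear (p := p) x zero add single

/-- The map `W[t] → W'[t]` induced by a linear map `W → W'` on coefficients. -/
noncomputable def map (u : W →ₗ[MvPolynomial ι k] W') :
    GradedExt k ι W →ₗ[MvPolynomial ι k] GradedExt k ι W' where
  toFun := PolynomialModule.map (MvPolynomial ι k) u
  map_add' := map_add (PolynomialModule.map (MvPolynomial ι k) u)
  map_smul' f x := by
    have := PolynomialModule.map_smul (MvPolynomial ι k) u (degreeMark k ι f) x
    rw [Algebra.algebraMap_self, Polynomial.map_id] at this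
    exact this

@[simp]
theorem coeff_map (u : W →ₗ[MvPolynomial ι k] W') (x : GradedExt k ι W) (d : ℕ) :
    (map u x).coeff k ι d = u (x.coeff k ι d) := by
  change ((PolynomialModule.map (MvPolynomial ι k) u) x).coeff d = _
  rfl

theorem map_single (u : W →ₗ[MvPolynomial ι k] W') (d : ℕ) (w : W) :
    map u (single k ι d w) = single k ι d (u w) :=
  PolynomialModule.map_single (MvPolynomial ι k) u d w

theorem map_injective {u : W →ₗ[MvPolynomial ι k] W'} (hu : Function.Injective u) :
    Function.Injective (map u) := fun x y hxy =>
  ext_coeff fun d => hu <| by rw [← coeff_map, ← coeff_map, hxy]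

theorem map_surjective {u : W →ₗ[MvPolynomial ι k] W'} (hu : Function.Surjective u) :
    Function.Surjective (map u) := fun y => by
  induction y using induction_single with
  | zero => exact ⟨0, map_zero _⟩
  | add y z hy hz =>
    obtain ⟨x, rfl⟩ := hy
    obtain ⟨x', rfl⟩ := hz
    exact ⟨x + x', map_add _ _ _⟩
  | single d w =>
    obtain ⟨x, rfl⟩ := hu w
    exact ⟨single k ι d x, map_single u d x⟩

theorem map_exact {W'' : Type*} [AddCommGroup W''] [Module (MvPolynomial ι k) W'']
    {u : W →ₗ[MvPolynomial ι k] W'} {u' : W' →ₗ[MvPolynomial ι k] W''}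
    (h : Function.Exact u u') : Function.Exact (map u) (map u') := fun y => by
  constructor
  · intro hy
    -- the preimages of the coefficients are chosen to vanish where `y` does, to have finite support
    have h1 : ∀ d, ∃ w, u w = y.coeff k ι d ∧ (y.coeff k ι d = 0 → w = 0) := fun d => by
      by_cases h0 : y.coeff k ι d = 0
      · exact ⟨0, by rw [map_zero, h0], fun _ => rfl⟩
      · have h2 : y.coeff k ι d ∈ Set.range u := by rw [← h, ← coeff_map, hy, coeff_zero]
        exact ⟨h2.choose, h2.choose_spec, fun h3 => absurd h3 h0⟩
    choose w hw hw0 using h1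
    refine ⟨PolynomialModule.ofCoeff _ (Finsupp.onFinset (y.coeff k ι).support w fun d hd =>
      Finsupp.mem_support_iff.mpr fun h0 => hd (hw0 d h0)), ext_coeff fun d => ?_⟩
    exact hw d
  · rintro ⟨x, rfl⟩
    refine ext_coeff fun d => ?_
    rw [coeff_map, coeff_map, h.apply_apply_eq_zero, coeff_zero]

end GradedExt

end GradedExt

end BihomElim

/-! ### Joint eigenvalues of a finite-dimensional module over a polynomial ring -/

namespace BihomElim

open Module

theorem isSeparable_aeval {k ι K : Type*} [Field k] [Field K] [Algebra k K] {v : ι → K}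
    (hv : ∀ i, IsSeparable k (v i)) (f : MvPolynomial ι k) :
    IsSeparable k (MvPolynomial.aeval v f) := by
  induction f using MvPolynomial.induction_on with
  | C a => simpa using isSeparable_algebraMap (K := K) a
  | add p q hp hq => rw [map_add]; exact Field.isSeparable_add hp hq
  | mul_X p i hp => rw [map_mul, MvPolynomial.aeval_X]; exact Field.isSeparable_mul hp (hv i)

section Points

variable {k ι : Type*} [Field k] (K : Type*) [Field K] [Algebra k K]
  [DecidableEq (ι → K)]

/-- The multiset `s` consists of the joint eigenvalues of the variables `x_i` on the
finite-dimensional `k[x]`-module `W`, with multiplicities: it computes all characteristic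
polynomials, its support is the zero locus of the annihilator of `W`, and at the points with
separable coordinates and `h = 1` the multiplicity is the length of `W[t]` at the homogeneous prime
of the point. -/
structure IsPointMultiset (h : MvPolynomial ι k) (W : Type*) [AddCommGroup W] [Module k W]
    [Module.Finite k W] [Module (MvPolynomial ι k) W] [IsScalarTower k (MvPolynomial ι k) W]
    (s : Multiset (ι → K)) : Prop where
  charpoly_map (g : MvPolynomial ι k) : (Algebra.lsmul k k W g).charpoly.map (algebraMap k K) =
    (s.map fun v => Polynomial.X - Polynomial.C (MvPolynomial.aeval v g)).prod
  mem_iff (v : ι → K) : v ∈ s ↔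
    ∀ f ∈ Module.annihilator (MvPolynomial ι k) W, MvPolynomial.aeval v f = 0
  length_eq (v : ι → K) (hv : ∀ i, IsSeparable k (v i)) (hvh : MvPolynomial.aeval v h = 1)
    (p : Ideal (MvPolynomial ι k)) [p.IsPrime]
    (hp : ∀ f, f ∈ p ↔ MvPolynomial.aeval
      (fun i => Polynomial.C (v i) * Polynomial.X : ι → Polynomial K) f = 0) :
    Module.length (Localization.AtPrime p) (LocalizedModule p.primeCompl (GradedExt k ι W)) =
      (s.count v : ℕ∞)

variable {K}

/-- A finite extension `L = k[x] / ψ` has as its points the images of the coordinates under the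
embeddings of `L`, with the inseparable degree as multiplicity. -/
theorem exists_multiset_of_field [IsAlgClosed K] {L : Type*} [Field L] [Algebra k L]
    [FiniteDimensional k L] (ψ : MvPolynomial ι k →ₐ[k] L) (hψ : Function.Surjective ψ) :
    ∃ s : Multiset (ι → K),
      (∀ g, (Algebra.lmul k L (ψ g)).charpoly.map (algebraMap k K) =
        (s.map fun v => Polynomial.X - Polynomial.C (MvPolynomial.aeval v g)).prod) ∧
      (∀ v, v ∈ s ↔ ∀ f, ψ f = 0 → MvPolynomial.aeval v f = 0) ∧
      (∀ v ∈ s, (∀ i, IsSeparable k (v i)) → s.count v = 1) := by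
  let pt : (L →ₐ[k] K) → ι → K := fun σ i => σ (ψ (MvPolynomial.X i))
  have hpt : ∀ σ f, MvPolynomial.aeval (pt σ) f = σ (ψ f) := fun σ f => by
    have : MvPolynomial.aeval (pt σ) = σ.comp ψ := by ext1 i; simp [pt]
    rw [this, AlgHom.comp_apply]
  have hinj : Function.Injective pt := fun σ τ hστ => by
    ext x
    obtain ⟨f, rfl⟩ := hψ x
    rw [← hpt, ← hpt, hστ]
  have hN : Field.finInsepDegree k L ≠ 0 := NeZero.ne _
  refine ⟨Field.finInsepDegree k L • (Finset.univ.val.map pt), fun g => ?_, fun v => ?_,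
    fun v hv hsep => ?_⟩
  · rw [charpoly_lmul_map_eq_prod_embeddings, Multiset.map_nsmul, Multiset.prod_nsmul,
      Multiset.map_map]
    simp only [Function.comp_apply, hpt]
    rfl
  · rw [Multiset.mem_nsmul_of_ne_zero hN, Multiset.mem_map]
    constructor
    · rintro ⟨σ, -, rfl⟩ f hf
      rw [hpt, hf, map_zero]
    · intro hv
      let e := Ideal.quotientKerAlgEquivOfSurjective hψ
      let σ : L →ₐ[k] K := (Ideal.Quotient.liftₐ (RingHom.ker ψ) (MvPolynomial.aeval v) hv).comp
        e.symm.toAlgHom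
      refine ⟨σ, Finset.mem_univ_val _, ?_⟩
      ext i
      have h1 : e.symm (ψ (MvPolynomial.X i)) = Ideal.Quotient.mk _ (MvPolynomial.X i) := by
        rw [AlgEquiv.symm_apply_eq]; rfl
      change (Ideal.Quotient.liftₐ (RingHom.ker ψ) (MvPolynomial.aeval v) hv)
        (e.symm (ψ (MvPolynomial.X i))) = v i
      rw [h1]
      exact MvPolynomial.aeval_X v i
  · rw [Multiset.mem_nsmul_of_ne_zero hN] at hv
    obtain ⟨σ, -, rfl⟩ := Multiset.mem_map.mp hv
    have : Algebra.IsSeparable k L := ⟨fun x => by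
      obtain ⟨f, rfl⟩ := hψ x
      rw [← isSeparable_map_iff σ σ.injective, ← hpt]
      exact isSeparable_aeval hsep f⟩
    rw [Algebra.IsSeparable.finInsepDegree_eq, one_nsmul]
    exact Multiset.count_eq_one_of_mem (Finset.univ.nodup.map hinj) hv


theorem IsPointMultiset.of_subsingleton (h : MvPolynomial ι k) (W : Type*) [AddCommGroup W]
    [Module k W] [Module.Finite k W] [Module (MvPolynomial ι k) W]
    [IsScalarTower k (MvPolynomial ι k) W] [Subsingleton W] : IsPointMultiset K h W 0 where
  charpoly_map g := by
    have h1 : (Algebra.lsmul k k W g).charpoly = 1 := by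
      rw [← Polynomial.Monic.natDegree_eq_zero (LinearMap.charpoly_monic _),
        LinearMap.charpoly_natDegree, Module.finrank_zero_of_subsingleton]
    simp [h1]
  mem_iff v := by
    simp only [Multiset.notMem_zero, false_iff, not_forall]
    exact ⟨1, by simp [Module.annihilator_eq_top_iff.mpr ‹Subsingleton W›], by simp⟩
  length_eq v _ _ p _ _ := by
    rw [length_localizedModule_eq_zero]
    · simp
    · exact fun x => ⟨1, Submonoid.one_mem _, GradedExt.ext_coeff fun d => Subsingleton.elim _ _⟩

/-- The case of a simple module, which is a finite extension field `L` of `k` generated by the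
images of the variables. -/
theorem IsPointMultiset.exists_of_equiv_field [IsAlgClosed K] {h : MvPolynomial ι k}
    (hh : h.IsHomogeneous 1) (W : Type*) [AddCommGroup W] [Module k W] [Module.Finite k W]
    [Module (MvPolynomial ι k) W] [IsScalarTower k (MvPolynomial ι k) W] (hW : ∀ w : W, h • w = w)
    {L : Type*} [Field L] [Algebra k L] [Algebra (MvPolynomial ι k) L]
    [IsScalarTower k (MvPolynomial ι k) L]
    (hL : Function.Surjective (algebraMap (MvPolynomial ι k) L))
    (e : W ≃ₗ[MvPolynomial ι k] L) : ∃ s, IsPointMultiset K h W s := by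
  have : Module.Finite k L := Module.Finite.equiv (e.restrictScalars k)
  let ψ := IsScalarTower.toAlgHom k (MvPolynomial ι k) L
  obtain ⟨s, hs1, hs2, hs3⟩ := exists_multiset_of_field (K := K) ψ hL
  let Q : Ideal (MvPolynomial ι k) := RingHom.ker ψ
  have hQ : Q.IsMaximal := RingHom.ker_isMaximal_of_surjective ψ hL
  have hw : ∀ (f : MvPolynomial ι k) (w : W), e (f • w) = ψ f * e w := fun f w => by
    rw [map_smul, Algebra.smul_def]; rfl
  have hann : ∀ f, f ∈ Module.annihilator (MvPolynomial ι k) W ↔ f ∈ Q := fun f => by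
    rw [Module.mem_annihilator, RingHom.mem_ker]
    constructor
    · intro hf
      have := hw f (e.symm 1)
      rwa [hf, map_zero, LinearEquiv.apply_symm_apply, mul_one, eq_comm] at this
    · intro hf w
      rw [← LinearEquiv.map_eq_zero_iff e, hw, hf, zero_mul]
  have hmem : ∀ v, v ∈ s ↔ ∀ f ∈ Q, MvPolynomial.aeval v f = 0 := hs2
  have hmod : ∀ f g : MvPolynomial ι k, h - 1 ∣ g - f → g - f ∈ Q := fun f g hfg => by
    obtain ⟨q, hq⟩ := hfg
    rw [← hann, Module.mem_annihilator]
    intro w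
    rw [hq, mul_comm, mul_smul, sub_smul, hW, one_smul, sub_self, smul_zero]
  have hh0 : ∀ v : ι → K, MvPolynomial.aeval v h = 1 → ∀ f g : MvPolynomial ι k, h - 1 ∣ g - f →
      MvPolynomial.aeval v g = MvPolynomial.aeval v f := fun v hv f g ⟨q, hq⟩ => by
    rw [← sub_eq_zero, ← map_sub, hq, map_mul, map_sub, hv, map_one, sub_self, zero_mul]
  refine ⟨s, fun g => ?_, fun v => ?_, fun v hv hvh p hp0 hp => ?_⟩
  · rw [← hs1, ← LinearEquiv.charpoly_conj (e.restrictScalars k)]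
    congr 2
    ext x
    obtain ⟨w, rfl⟩ := e.surjective x
    change e (g • e.symm (e w)) = ψ g * e w
    rw [LinearEquiv.symm_apply_apply, hw]
  · simp only [hann, hmem]
  · -- at a point of `L` the localization is the residue field, elsewhere it vanishes
    by_cases hvs : v ∈ s
    · rw [hs3 v hvs hv, Nat.cast_one]
      have hker : ∀ f, MvPolynomial.aeval v f = 0 ↔ f ∈ Q := fun f => by
        have h1 : RingHom.ker (MvPolynomial.aeval (R := k) v) = Q :=
          (hQ.eq_of_le (RingHom.ker_ne_top _) ((hmem v).mp hvs)).symm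
        rw [← h1, RingHom.mem_ker]
      have hw0 : ∀ f : MvPolynomial ι k, f • e.symm 1 = 0 ↔ f ∈ Q := fun f => by
        rw [← LinearEquiv.map_eq_zero_iff e, hw, LinearEquiv.apply_symm_apply, mul_one,
          RingHom.mem_ker]
      refine length_localizedModule_eq_one p (GradedExt.single k ι 0 (e.symm 1)) (fun f => ?_)
        fun x => ?_
      · rw [hp, aeval_C_mul_X_eq_zero_iff]
        constructor
        · intro hf d
          rw [hker, ← hw0]
          have := GradedExt.coeff_smul_single f 0 (e.symm 1) d
          rw [hf] at this
          simpa using this.symm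
        · intro hf
          refine GradedExt.ext_coeff fun d => ?_
          rw [GradedExt.coeff_smul_single, if_pos (Nat.zero_le _), Nat.sub_zero,
            GradedExt.coeff_zero, hw0, ← hker]
          exact hf d
      · have hhp : h ∈ p.primeCompl := fun hmem => by
          have h1 := (aeval_C_mul_X_eq_zero_iff v h).mp ((hp h).mp hmem) 1
          rw [MvPolynomial.homogeneousComponent_of_mem hh, if_pos rfl, hvh] at h1
          exact one_ne_zero h1
        induction x using GradedExt.induction_single with
        | zero => exact ⟨1, Submonoid.one_mem _, 0, by simp⟩
        | add x y hx hy =>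
          obtain ⟨t, ht, f, hf⟩ := hx
          obtain ⟨u, hu, g, hg⟩ := hy
          refine ⟨t * u, Submonoid.mul_mem _ ht hu, u * f + t * g, ?_⟩
          rw [smul_add, add_smul, mul_smul u f, ← hf, mul_smul t g, ← hg, smul_smul, smul_smul,
            mul_comm u t]
        | single d w =>
          obtain ⟨f, hf⟩ := hL (e w)
          obtain ⟨D, g, hg, hgf⟩ := exists_isHomogeneous_sub_dvd hh f
          have hgw : g • e.symm 1 = w := by
            rw [← e.injective.eq_iff, hw, LinearEquiv.apply_symm_apply, mul_one, ← hf,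
              ← sub_eq_zero]
            exact (map_sub ψ g f).symm.trans (RingHom.mem_ker.mp (hmod f g hgf))
          have hhom : ∀ j, (h ^ j).IsHomogeneous j := fun j => by simpa using hh.pow j
          -- `h ^ D` raises the degree by `D`, and `g` is homogeneous of degree `D`, so that
          -- `h ^ D • w t ^ d` and `h ^ d * g` applied to the generator have the same degree in `t`
          refine ⟨h ^ D, Submonoid.pow_mem _ hhp D, h ^ d * g, ?_⟩
          rw [GradedExt.smul_single_of_isHomogeneous (hhom D),
            GradedExt.smul_single_of_isHomogeneous ((hhom d).mul hg), mul_smul, hgw,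
            pow_smul_eq_self (hW _), pow_smul_eq_self (hW _),
            add_zero, add_comm]
    · rw [Multiset.count_eq_zero_of_notMem hvs, Nat.cast_zero]
      rw [hmem] at hvs
      push Not at hvs
      obtain ⟨f, hfQ, hfv⟩ := hvs
      obtain ⟨D, g, hg, hgf⟩ := exists_isHomogeneous_sub_dvd hh f
      -- the homogenization `g` of `f` kills `W`, hence `W[t]`, and does not vanish at `v`
      refine length_localizedModule_eq_zero _ fun x => ⟨g, fun hgp => hfv ?_, ?_⟩
      · have h1 := (aeval_C_mul_X_eq_zero_iff v g).mp ((hp g).mp hgp) D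
        rwa [MvPolynomial.homogeneousComponent_of_mem hg, if_pos rfl, hh0 v hvh f g hgf] at h1
      · refine GradedExt.ext_coeff fun d => ?_
        have hgQ : g ∈ Q := by
          have := Q.add_mem (hmod f g hgf) hfQ
          rwa [sub_add_cancel] at this
        rw [GradedExt.coeff_smul_of_isHomogeneous hg, GradedExt.coeff_zero,
          Module.mem_annihilator.mp ((hann g).mpr hgQ), ite_self]

theorem IsPointMultiset.exists_of_isSimpleModule [IsAlgClosed K] {h : MvPolynomial ι k}
    (hh : h.IsHomogeneous 1) (W : Type*) [AddCommGroup W]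
    [Module k W] [Module.Finite k W] [Module (MvPolynomial ι k) W]
    [IsScalarTower k (MvPolynomial ι k) W] [IsSimpleModule (MvPolynomial ι k) W]
    (hW : ∀ w : W, h • w = w) : ∃ s, IsPointMultiset K h W s := by
  obtain ⟨Q, hQ, ⟨e⟩⟩ := isSimpleModule_iff_quot_maximal.mp ‹IsSimpleModule (MvPolynomial ι k) W›
  let _ : Field (MvPolynomial ι k ⧸ Q) := Ideal.Quotient.field Q
  exact IsPointMultiset.exists_of_equiv_field hh W hW Ideal.Quotient.mk_surjective e

theorem IsPointMultiset.add_of_exact {h : MvPolynomial ι k} {A B C : Type*} [AddCommGroup A]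
    [AddCommGroup B] [AddCommGroup C] [Module k A] [Module k B] [Module k C] [Module.Finite k A]
    [Module.Finite k B] [Module.Finite k C] [Module (MvPolynomial ι k) A]
    [Module (MvPolynomial ι k) B] [Module (MvPolynomial ι k) C]
    [IsScalarTower k (MvPolynomial ι k) A] [IsScalarTower k (MvPolynomial ι k) B]
    [IsScalarTower k (MvPolynomial ι k) C] {i : A →ₗ[MvPolynomial ι k] B}
    {p : B →ₗ[MvPolynomial ι k] C} (hi : Function.Injective i) (hp : Function.Surjective p)
    (hip : Function.Exact i p) {s t : Multiset (ι → K)} (hs : IsPointMultiset K h A s)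
    (ht : IsPointMultiset K h C t) : IsPointMultiset K h B (s + t) where
  charpoly_map g := by
    rw [Multiset.map_add, Multiset.prod_add, ← hs.charpoly_map, ← ht.charpoly_map,
      ← Polynomial.map_mul]
    congr 1
    refine charpoly_eq_mul_of_exact (i := i.restrictScalars k) (p := p.restrictScalars k) hi hp hip
      ?_ ?_
    · ext x
      exact (i.map_smul g x).symm
    · ext x
      exact (p.map_smul g x).symm
  mem_iff v := by
    rw [Multiset.mem_add, hs.mem_iff, ht.mem_iff]
    constructor
    · rintro (hv | hv) f hf
      · exact hv f (i.annihilator_le_of_injective hi hf)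
      · exact hv f (p.annihilator_le_of_surjective hp hf)
    · intro hv
      -- the product of the annihilators of `A` and `C` annihilates `B`
      by_contra hcon
      push Not at hcon
      obtain ⟨⟨f, hf, hfv⟩, g, hg, hgv⟩ := hcon
      have h1 : MvPolynomial.aeval v (f * g) = 0 := hv _ <| Module.mem_annihilator.mpr fun b => by
        have h2 : p (g • b) = 0 := by rw [map_smul]; exact Module.mem_annihilator.mp hg _
        obtain ⟨a, ha⟩ := (hip _).mp h2
        rw [mul_smul, ← ha, ← map_smul, Module.mem_annihilator.mp hf, map_zero]
      rw [map_mul] at h1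
      exact (mul_ne_zero hfv hgv) h1
  length_eq v hv hvh P _ hP := by
    rw [length_localizedModule_add _ (GradedExt.map_injective hi) (GradedExt.map_surjective hp)
      (GradedExt.map_exact hip), hs.length_eq v hv hvh P hP, ht.length_eq v hv hvh P hP,
      Multiset.count_add, Nat.cast_add]

/-- Every finite-dimensional `k[x]`-module on which a linear form `h` acts as the identity has a
multiset of joint eigenvalues; it is assembled from the simple constituents of the module. -/
theorem exists_isPointMultiset [IsAlgClosed K] {h : MvPolynomial ι k} (hh : h.IsHomogeneous 1)
    (W : Type*) [AddCommGroup W] [Module k W] [Module.Finite k W] [Module (MvPolynomial ι k) W]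
    [IsScalarTower k (MvPolynomial ι k) W] (hW : ∀ w : W, h • w = w) :
    ∃ s, IsPointMultiset K h W s := by
  obtain ⟨d, hd⟩ : ∃ d, finrank k W = d := ⟨_, rfl⟩
  induction d using Nat.strong_induction_on generalizing W with
  | _ d ih =>
    rcases subsingleton_or_nontrivial W with hsub | hnt
    · exact ⟨0, .of_subsingleton h W⟩
    · have : Module.Finite (MvPolynomial ι k) W := Module.Finite.of_restrictScalars_finite k _ W
      obtain ⟨N, hN⟩ := IsCoatomic.exists_coatom (Submodule (MvPolynomial ι k) W)
      have : IsSimpleModule (MvPolynomial ι k) (W ⧸ N) := isSimpleModule_iff_isCoatom.mpr hN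
      have : Module.Finite k N := inferInstanceAs (Module.Finite k (N.restrictScalars k))
      have : Module.Finite k (W ⧸ N) :=
        Module.Finite.of_surjective (N.mkQ.restrictScalars k) N.mkQ_surjective
      have hlt : finrank k N < d := by
        rw [← hd]
        refine Submodule.finrank_lt (s := N.restrictScalars k) fun htop => hN.1 ?_
        rwa [Submodule.restrictScalars_eq_top_iff] at htop
      obtain ⟨s, hs⟩ := ih _ hlt N (fun w => Subtype.ext (hW w)) rfl
      obtain ⟨t, ht⟩ := IsPointMultiset.exists_of_isSimpleModule (K := K) hh (W ⧸ N) fun w => by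
        obtain ⟨w, rfl⟩ := N.mkQ_surjective w
        rw [← map_smul, hW]
      exact ⟨s + t, hs.add_of_exact N.injective_subtype N.mkQ_surjective
        (LinearMap.exact_subtype_mkQ N) ht⟩

end Points
end BihomElim

/-! ### Bihomogeneous pieces and multiplication by the linear form -/

namespace BihomElim

open MvPolynomial

section Weighted

variable {F σ M : Type*} [Field F] [AddCommMonoid M] {w : σ → M}

/-- Weighted homogeneous polynomials all of whose monomials contain a variable from a given set are
sums of products of such a variable with a weighted homogeneous polynomial. -/
theorem isWeightedHomogeneous_induction_X_mul {T : σ → Prop} {m : M}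
    (hT : ∀ e : σ →₀ ℕ, Finsupp.weight w e = m → ∃ i, T i ∧ e i ≠ 0)
    {p : MvPolynomial σ F → Prop} (zero : p 0) (add : ∀ f g, p f → p g → p (f + g))
    (mul : ∀ i g m', T i → w i + m' = m → IsWeightedHomogeneous w g m' → p (X i * g))
    (f : MvPolynomial σ F) (hf : IsWeightedHomogeneous w f m) : p f := by
  classical
  rw [f.as_sum]
  refine Finset.sum_induction _ p add zero fun e he => ?_
  have hwe := hf (mem_support_iff.mp he)
  obtain ⟨i, hi, hei⟩ := hT e hwe
  have hadd : Finsupp.single i 1 + (e - Finsupp.single i 1) = e :=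
    add_tsub_cancel_of_le (Finsupp.single_le_iff.mpr (Nat.one_le_iff_ne_zero.mpr hei))
  have h1 : monomial e (coeff e f) = X i * monomial (e - Finsupp.single i 1) (coeff e f) := by
    rw [X, monomial_mul, hadd, one_mul]
  rw [h1]
  refine mul i _ (Finsupp.weight w (e - Finsupp.single i 1)) hi ?_
    (isWeightedHomogeneous_monomial _ _ _ rfl)
  rw [← hwe]
  nth_rewrite 2 [← hadd]
  rw [map_add, Finsupp.weight_single, one_smul]

theorem weightedHomogeneousComponent_add_mul [IsLeftCancelAdd M] {q : MvPolynomial σ F} {d : M}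
    (hq : IsWeightedHomogeneous w q d) (e : M) (f : MvPolynomial σ F) :
    weightedHomogeneousComponent w (d + e) (q * f) = q * weightedHomogeneousComponent w e f := by
  classical
  induction f using MvPolynomial.induction_on' with
  | monomial u c =>
    have h1 := isWeightedHomogeneous_monomial w u c rfl
    rw [weightedHomogeneousComponent_of_mem (hq.mul h1), weightedHomogeneousComponent_of_mem h1]
    simp only [add_right_inj, mul_ite, mul_zero]
  | add f g hf hg => rw [mul_add, map_add, map_add, mul_add, hf, hg]

theorem weightedHomogeneousComponent_mul_eq_zero {q : MvPolynomial σ F} {d : M}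
    (hq : IsWeightedHomogeneous w q d) {e : M} (he : ∀ d', d + d' ≠ e) (f : MvPolynomial σ F) :
    weightedHomogeneousComponent w e (q * f) = 0 := by
  classical
  induction f using MvPolynomial.induction_on' with
  | monomial u c =>
    have h1 := isWeightedHomogeneous_monomial w u c rfl
    rw [weightedHomogeneousComponent_of_mem (hq.mul h1), if_neg (he _).symm]
  | add f g hf hg => rw [mul_add, map_add, hf, hg, add_zero]

end Weighted

variable {k : Type*} [Field k] {n m : ℕ}

theorem smul_eq_mul_biRing (f : XRing k n) (r : BiRing k n m) :
    f • r = algebraMap (XRing k n) (BiRing k n m) f * r := Algebra.smul_def f r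

theorem algebraMap_mem_biPiece {f : XRing k n} {j : ℕ} (hf : f.IsHomogeneous j) :
    IsWeightedHomogeneous (biWeight n m) (algebraMap (XRing k n) (BiRing k n m) f) (j, 0) := by
  intro d hd
  rw [algebraMap_eq_rename] at hd
  obtain ⟨u, rfl, hu⟩ := coeff_rename_ne_zero _ _ _ hd
  have hu' : u.degree = j := by
    rw [← hf hu, Finsupp.degree_eq_weight_one]
    rfl
  rw [weight_mapDomain_inl, hu']

theorem smul_mem_biPiece {f : XRing k n} {j : ℕ} (hf : f.IsHomogeneous j) {r : BiRing k n m}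
    {c d : ℕ} (hr : r ∈ biPiece k n m (c, d)) : f • r ∈ biPiece k n m (c + j, d) := by
  have h1 := (algebraMap_mem_biPiece (m := m) hf).mul hr
  rw [Prod.mk_add_mk, zero_add, add_comm j c] at h1
  rw [smul_eq_mul_biRing]
  exact h1

theorem biPiece_succ_induction {c d : ℕ} {p : BiRing k n m → Prop} (zero : p 0)
    (add : ∀ f g, p f → p g → p (f + g))
    (smul : ∀ (i : Fin (n + 1)) (g : BiRing k n m), g ∈ biPiece k n m (c, d) →
      p ((X i : XRing k n) • g))
    (r : BiRing k n m) (hr : r ∈ biPiece k n m (c + 1, d)) : p r := by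
  refine isWeightedHomogeneous_induction_X_mul (w := biWeight n m) (T := fun s => s.isLeft = true)
    ?_ zero add ?_ r hr
  · intro e he
    by_contra hcon
    push Not at hcon
    have h1 : (Finsupp.weight (biWeight n m) e).1 = 0 := by
      rw [Finsupp.weight_apply, Finsupp.sum, Prod.fst_sum]
      refine Finset.sum_eq_zero fun i _ => ?_
      rcases i with i | i
      · simp [hcon (Sum.inl i) rfl]
      · simp [biWeight]
    rw [he] at h1
    simp at h1
  · rintro (i | i) g ⟨c', d'⟩ hi hw hg
    · have h1 := smul i g (by
        simp only [biWeight, Sum.elim_inl, Prod.mk_add_mk, Prod.mk.injEq] at hw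
        have h2 : c' = c := by omega
        have h3 : d' = d := by omega
        subst h2 h3
        exact hg)
      rwa [smul_eq_mul_biRing, algebraMap_eq_rename, rename_X] at h1
    · simp at hi

theorem isHomogeneous_succ_induction {d : ℕ} {p : XRing k n → Prop} (zero : p 0)
    (add : ∀ f g, p f → p g → p (f + g))
    (mul : ∀ (i : Fin (n + 1)) (g : XRing k n), g.IsHomogeneous d → p (X i * g))
    (f : XRing k n) (hf : f.IsHomogeneous (d + 1)) : p f := by
  refine isWeightedHomogeneous_induction_X_mul (w := (1 : Fin (n + 1) → ℕ)) (T := fun _ => True)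
    ?_ zero add ?_ f hf
  · intro e he
    by_contra hcon
    push Not at hcon
    have : e = 0 := Finsupp.ext fun i => hcon i trivial
    rw [this] at he
    simp at he
  · intro i g d' _ hw hg
    have : d' = d := by
      simp only [Pi.one_apply] at hw
      omega
    subst this
    exact mul i g hg

/-- The monomial `y ^ β` of `k[x, y]`. -/
noncomputable def yMonomial (k : Type*) [Field k] (n : ℕ) {m : ℕ} (β : Fin (m + 1) →₀ ℕ) :
    BiRing k n m :=
  monomial (β.mapDomain Sum.inr) 1

theorem weight_mapDomain_inr (u : Fin (m + 1) →₀ ℕ) :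
    Finsupp.weight (biWeight n m) (u.mapDomain Sum.inr) = (0, u.degree) := by
  induction u using Finsupp.induction_linear with
  | zero => simp; rfl
  | add f g hf hg => simp [Finsupp.mapDomain_add, map_add, hf, hg]
  | single i c => simp [Finsupp.mapDomain_single, Finsupp.weight_single, biWeight]

theorem yMonomial_mem_biPiece (β : Fin (m + 1) →₀ ℕ) :
    yMonomial k n β ∈ biPiece k n m (0, β.degree) :=
  isWeightedHomogeneous_monomial _ _ _ (weight_mapDomain_inr β)

theorem sumFinsuppEquivProdFinsupp_symm_eq_add (α : Fin (n + 1) →₀ ℕ) (β : Fin (m + 1) →₀ ℕ) :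
    Finsupp.sumFinsuppEquivProdFinsupp.symm (α, β) =
      α.mapDomain Sum.inl + β.mapDomain Sum.inr := by
  ext (i | i)
  · simp [Finsupp.mapDomain_apply Sum.inl_injective, Finsupp.mapDomain_of_notMem_range]
  · simp [Finsupp.mapDomain_apply Sum.inr_injective, Finsupp.mapDomain_of_notMem_range]

/-- Every monomial of `k[x, y]` is `x ^ α y ^ β`. -/
theorem monomial_eq_smul_yMonomial (e : Fin (n + 1) ⊕ Fin (m + 1) →₀ ℕ) (c : k) :
    (monomial e c : BiRing k n m) =
      (monomial (Finsupp.sumFinsuppEquivProdFinsupp e).1 c : XRing k n) •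
        yMonomial k n (Finsupp.sumFinsuppEquivProdFinsupp e).2 := by
  obtain ⟨⟨α, β⟩, rfl⟩ := Finsupp.sumFinsuppEquivProdFinsupp.symm.surjective e
  rw [smul_eq_mul_biRing, algebraMap_eq_rename, rename_monomial, yMonomial, monomial_mul, mul_one,
    Equiv.apply_symm_apply, sumFinsuppEquivProdFinsupp_symm_eq_add]

/-- An additive property of polynomials of bidegree `(c, d)` has to be checked only on
`f y ^ β` with `f` of degree `c` and `y ^ β` of degree `d`. -/
theorem biPiece_induction {c d : ℕ} {p : BiRing k n m → Prop} (zero : p 0)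
    (add : ∀ f g, p f → p g → p (f + g))
    (smul : ∀ (f : XRing k n) (β : Fin (m + 1) →₀ ℕ), f.IsHomogeneous c → β.degree = d →
      p (f • yMonomial k n β))
    (r : BiRing k n m) (hr : r ∈ biPiece k n m (c, d)) : p r := by
  rw [r.as_sum]
  refine Finset.sum_induction _ p add zero fun e he => ?_
  rw [monomial_eq_smul_yMonomial]
  have hwe := hr (mem_support_iff.mp he)
  obtain ⟨⟨α, β⟩, rfl⟩ := Finsupp.sumFinsuppEquivProdFinsupp.symm.surjective e
  rw [sumFinsuppEquivProdFinsupp_symm_eq_add, map_add, weight_mapDomain_inl, weight_mapDomain_inr,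
    Prod.mk_add_mk, Prod.mk.injEq, add_zero, zero_add] at hwe
  rw [Equiv.apply_symm_apply]
  exact smul _ _ (isHomogeneous_monomial _ hwe.1) hwe.2

section Admissible

variable {I : Ideal (BiRing k n m)} {a b : ℕ} {h : XRing k n}

theorem coe_mulBar {j : ℕ} {g : XRing k n} (hg : g.IsHomogeneous j) (v : quotPiece I a b) :
    (mulBar I a b hg v : BiRing k n m ⧸ I) = g • (v : BiRing k n m ⧸ I) :=
  (Algebra.smul_def g (v : BiRing k n m ⧸ I)).symm

theorem mk_smul (f : XRing k n) (r : BiRing k n m) :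
    Ideal.Quotient.mk I (f • r) = f • Ideal.Quotient.mk I r := rfl

theorem mk_mem_quotPiece {c d : ℕ} {r : BiRing k n m} (hr : r ∈ biPiece k n m (c, d)) :
    Ideal.Quotient.mk I r ∈ quotPiece I c d := ⟨r, hr, rfl⟩

theorem exists_rep {c d : ℕ} (v : quotPiece I c d) :
    ∃ r ∈ biPiece k n m (c, d), Ideal.Quotient.mk I r = v := v.2

/-- The characterization `p (m_{g/p} v) = g v` of `m_{g/p}`, inside `R/I`. -/
theorem fracMul_apply_eq_iff {j : ℕ} {p g : XRing k n} (hp : p.IsHomogeneous j)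
    (hinv : Function.Bijective (mulBar I a b hp)) (hg : g.IsHomogeneous j)
    (v u : quotPiece I a b) :
    fracMul I a b hp hinv hg v = u ↔
      p • (u : BiRing k n m ⧸ I) = g • (v : BiRing k n m ⧸ I) := by
  rw [← coe_mulBar hp, ← coe_mulBar hg, Subtype.coe_inj, fracMul, LinearMap.comp_apply,
    LinearEquiv.coe_coe, LinearEquiv.symm_apply_eq, eq_comm]
  rfl

theorem mem_sup_of_mem_biPiece (hadm : IsAdmissible I a b h) {r : BiRing k n m}
    (hr : r ∈ biPiece k n m (a, b)) : ∃ w : BiRing k n m, r - h • w ∈ I := by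
  have h1 : quotPiece (I ⊔ Ideal.span {algebraMap (XRing k n) (BiRing k n m) h}) a b = ⊥ :=
    Submodule.finrank_eq_zero.mp hadm.hilbertFun_sup
  have h2 := mk_mem_quotPiece
    (I := I ⊔ Ideal.span {algebraMap (XRing k n) (BiRing k n m) h}) hr
  rw [h1, Submodule.mem_bot, Ideal.Quotient.eq_zero_iff_mem] at h2
  obtain ⟨i, hi, z, hz, hiz⟩ := Submodule.mem_sup.mp h2
  obtain ⟨w, hw⟩ := Ideal.mem_span_singleton'.mp hz
  refine ⟨w, ?_⟩
  rwa [← hiz, ← hw, smul_eq_mul_biRing, mul_comm w, add_sub_cancel_right]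

theorem component_mem (hI : IsBihomogeneous I) {r : BiRing k n m} (hr : r ∈ I) (d : ℕ × ℕ) :
    weightedHomogeneousComponent (biWeight n m) d r ∈ I :=
  weightedHomogeneousComponent_mem_of_mem k (biWeight n m) hI hr d

theorem component_succ_smul {g : XRing k n} (hg : g.IsHomogeneous 1) (c d : ℕ)
    (r : BiRing k n m) : weightedHomogeneousComponent (biWeight n m) (c + 1, d) (g • r) =
      g • weightedHomogeneousComponent (biWeight n m) (c, d) r := by
  have := weightedHomogeneousComponent_add_mul (algebraMap_mem_biPiece (m := m) hg) (c, d) r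
  rwa [Prod.mk_add_mk, zero_add, add_comm 1 c, ← smul_eq_mul_biRing, ← smul_eq_mul_biRing] at this

theorem component_zero_smul {g : XRing k n} (hg : g.IsHomogeneous 1) (d : ℕ)
    (r : BiRing k n m) : weightedHomogeneousComponent (biWeight n m) (0, d) (g • r) = 0 := by
  rw [smul_eq_mul_biRing]
  refine weightedHomogeneousComponent_mul_eq_zero (algebraMap_mem_biPiece (m := m) hg) ?_ r
  rintro ⟨c', d'⟩ hc
  simp at hc

/-- `(R/(I, h))_{a, b} = 0` means that `(R/I)_{a, b}` consists of multiples of `h`. -/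
theorem exists_sub_smul_mem {c : ℕ} (hI : IsBihomogeneous I) (hadm : IsAdmissible I (c + 1) b h)
    {r : BiRing k n m} (hr : r ∈ biPiece k n m (c + 1, b)) :
    ∃ w ∈ biPiece k n m (c, b), r - h • w ∈ I := by
  obtain ⟨w, hw⟩ := mem_sup_of_mem_biPiece hadm hr
  refine ⟨_, weightedHomogeneousComponent_mem (biWeight n m) w (c, b), ?_⟩
  have := component_mem hI hw (c + 1, b)
  rwa [map_sub, component_succ_smul hadm.isLinearForm,
    IsWeightedHomogeneous.weightedHomogeneousComponent_same hr] at this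

theorem mem_of_mem_biPiece_zero (hI : IsBihomogeneous I) (hadm : IsAdmissible I 0 b h)
    {r : BiRing k n m} (hr : r ∈ biPiece k n m (0, b)) : r ∈ I := by
  obtain ⟨w, hw⟩ := mem_sup_of_mem_biPiece hadm hr
  have := component_mem hI hw (0, b)
  rwa [map_sub, component_zero_smul hadm.isLinearForm, sub_zero,
    IsWeightedHomogeneous.weightedHomogeneousComponent_same hr] at this

/-- As `R_{a + j + 1, b}` is generated by `R_{a, b}`, divisibility by `h` persists in higher
degrees. -/
theorem exists_sub_smul_mem_of_le (hI : IsBihomogeneous I) (hadm : IsAdmissible I a b h) (j : ℕ)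
    {r : BiRing k n m} (hr : r ∈ biPiece k n m (a + j + 1, b)) :
    ∃ w ∈ biPiece k n m (a + j, b), r - h • w ∈ I := by
  have hzero : ∀ c, ∃ w ∈ biPiece k n m (c, b), (0 : BiRing k n m) - h • w ∈ I := fun c =>
    ⟨0, Submodule.zero_mem _, by simp⟩
  have hadd : ∀ c (r s : BiRing k n m), (∃ w ∈ biPiece k n m (c, b), r - h • w ∈ I) →
      (∃ w ∈ biPiece k n m (c, b), s - h • w ∈ I) →
      ∃ w ∈ biPiece k n m (c, b), (r + s) - h • w ∈ I := by
    rintro c r s ⟨w, hw, hr⟩ ⟨z, hz, hs⟩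
    refine ⟨w + z, Submodule.add_mem _ hw hz, ?_⟩
    rw [smul_add, add_sub_add_comm]
    exact I.add_mem hr hs
  have hstep : ∀ c (i : Fin (n + 1)) (r : BiRing k n m),
      (∃ w ∈ biPiece k n m (c, b), r - h • w ∈ I) →
      ∃ w ∈ biPiece k n m (c + 1, b), (X i : XRing k n) • r - h • w ∈ I := by
    rintro c i r ⟨w, hw, hr⟩
    refine ⟨(X i : XRing k n) • w, smul_mem_biPiece (isHomogeneous_X k i) hw, ?_⟩
    rw [smul_comm h, ← smul_sub, smul_eq_mul_biRing]
    exact I.mul_mem_left _ hr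
  induction j generalizing r with
  | zero =>
    refine biPiece_succ_induction (hzero _) (hadd _) (fun i g hg => ?_) r hr
    rcases a with - | c
    · refine ⟨0, Submodule.zero_mem _, ?_⟩
      rw [smul_zero, sub_zero, smul_eq_mul_biRing]
      exact I.mul_mem_left _ (mem_of_mem_biPiece_zero hI hadm hg)
    · exact hstep c i g (exists_sub_smul_mem hI hadm hg)
  | succ j ih =>
    exact biPiece_succ_induction (hzero _) (hadd _) (fun i g hg => hstep _ i g (ih hg)) r hr

theorem exists_sub_pow_smul_mem (hI : IsBihomogeneous I) (hadm : IsAdmissible I a b h) (j : ℕ)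
    {r : BiRing k n m} (hr : r ∈ biPiece k n m (a + j, b)) :
    ∃ w ∈ biPiece k n m (a, b), r - (h ^ j) • w ∈ I := by
  induction j generalizing r with
  | zero => exact ⟨r, hr, by simp⟩
  | succ j ih =>
    obtain ⟨w, hw, hrw⟩ := exists_sub_smul_mem_of_le hI hadm j hr
    obtain ⟨z, hz, hwz⟩ := ih hw
    refine ⟨z, hz, ?_⟩
    have h1 : r - h ^ (j + 1) • z = (r - h • w) + h • (w - h ^ j • z) := by
      rw [smul_sub, smul_smul, ← pow_succ', sub_add_sub_cancel]
    rw [h1, smul_eq_mul_biRing]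
    exact I.add_mem hrw (I.mul_mem_left _ hwz)

theorem mulBar_pow_surjective (hI : IsBihomogeneous I) (hadm : IsAdmissible I a b h) (j : ℕ) :
    Function.Surjective (mulBar I a b (hadm.pow_isHomogeneous j)) := fun v => by
  obtain ⟨r, hr, hrv⟩ := exists_rep v
  obtain ⟨w, hw, hrw⟩ := exists_sub_pow_smul_mem hI hadm j hr
  refine ⟨⟨_, mk_mem_quotPiece hw⟩, Subtype.ext ?_⟩
  rw [coe_mulBar, ← hrv, ← mk_smul]
  exact (Ideal.Quotient.eq.mpr hrw).symm

/-- Equality of the Hilbert function at `a` and `a + 1` makes multiplication by `h` bijective. -/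
theorem mulBar_bijective (hI : IsBihomogeneous I) (hadm : IsAdmissible I a b h) :
    Function.Bijective (mulBar I a b hadm.isLinearForm) := by
  have hsurj : Function.Surjective (mulBar I a b hadm.isLinearForm) := fun v => by
    obtain ⟨u, hu⟩ := mulBar_pow_surjective hI hadm 1 v
    refine ⟨u, Subtype.ext ?_⟩
    rw [← hu, coe_mulBar, coe_mulBar, pow_one]
  exact ⟨(LinearMap.injective_iff_surjective_of_finrank_eq_finrank hadm.hilbertFun_eq).mpr hsurj,
    hsurj⟩

end Admissible

end BihomElim

/-! ### The module structure on a bigraded piece -/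

namespace BihomElim

open MvPolynomial

theorem exists_aeval_of_commute {F ι B : Type*} [Field F] [Ring B] [Algebra F B] (T : ι → B)
    (hT : ∀ i j, T i * T j = T j * T i) :
    ∃ ρ : MvPolynomial ι F →ₐ[F] B, ∀ i, ρ (X i) = T i := by
  have : IsMulCommutative (Algebra.adjoin F (Set.range T)) := Algebra.isMulCommutative_adjoin F (by
    rintro _ ⟨i, rfl⟩ _ ⟨j, rfl⟩
    exact hT i j)
  let _ : CommRing (Algebra.adjoin F (Set.range T)) :=
    { (inferInstance : Ring (Algebra.adjoin F (Set.range T))) with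
      mul_comm := this.is_comm.comm }
  let τ : MvPolynomial ι F →ₐ[F] Algebra.adjoin F (Set.range T) :=
    aeval fun i => (⟨T i, Algebra.subset_adjoin ⟨i, rfl⟩⟩ : Algebra.adjoin F (Set.range T))
  refine ⟨(Algebra.adjoin F (Set.range T)).val.comp τ, fun i => ?_⟩
  rw [AlgHom.comp_apply, aeval_X]
  rfl

variable {k : Type*} [Field k] {n m : ℕ}

section Operators

variable {I : Ideal (BiRing k n m)} {a b : ℕ} {h : XRing k n}

/-- `(R/I)_{a, b}` becomes a `k[x]`-module when `x_i` acts as `h⁻¹ x_i`: these operators commute,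
because `(R/I)_{a, b}` consists of multiples `h w`, on which they are multiplication by `x_i`
followed by cancellation of `h`. The action `ρ` is determined by `ρ(f) [h ^ d w] = [f w]` for `f` of
degree `d`. -/
theorem exists_operators (hI : IsBihomogeneous I) (hadm : IsAdmissible I a b h) :
    ∃ ρ : XRing k n →ₐ[k] Module.End k (quotPiece I a b), ρ h = 1 ∧
      ∀ (d c : ℕ) (f : XRing k n) (w : BiRing k n m) (v : quotPiece I a b), c + d = a →
        f.IsHomogeneous d → w ∈ biPiece k n m (c, b) → (v : BiRing k n m ⧸ I) =
          Ideal.Quotient.mk I (h ^ d • w) → (ρ f v : BiRing k n m ⧸ I) =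
          Ideal.Quotient.mk I (f • w) := by
  rcases a with - | a
  · -- here `(R/I)_{0, b} = 0`, and any action will do
    have hv : ∀ v : quotPiece I 0 b, v = 0 := fun v => by
      obtain ⟨r, hr, hrv⟩ := exists_rep v
      rw [Ideal.Quotient.eq_zero_iff_mem.mpr (mem_of_mem_biPiece_zero hI hadm hr)] at hrv
      exact Subtype.ext hrv.symm
    obtain ⟨ρ, -⟩ := exists_aeval_of_commute (F := k)
      (fun _ : Fin (n + 1) => (0 : Module.End k (quotPiece I 0 b))) fun _ _ => rfl
    refine ⟨ρ, LinearMap.ext fun v => by rw [hv v, map_zero, map_zero], ?_⟩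
    intro d c f w v hcd hf hw _
    obtain rfl : c = 0 := by omega
    obtain rfl : d = 0 := by omega
    rw [hv (ρ f v), smul_eq_mul_biRing]
    exact (Ideal.Quotient.eq_zero_iff_mem.mpr
      (I.mul_mem_left _ (mem_of_mem_biPiece_zero hI hadm hw))).symm
  have hbij := mulBar_bijective hI hadm
  let T : Fin (n + 1) → Module.End k (quotPiece I (a + 1) b) := fun i =>
    fracMul I (a + 1) b hadm.isLinearForm hbij (isHomogeneous_X k i)
  have hT : ∀ i v u, T i v = u ↔ h • (u : BiRing k n m ⧸ I) = (X i : XRing k n) • v.1 :=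
    fun i v u => fracMul_apply_eq_iff hadm.isLinearForm hbij (isHomogeneous_X k i) v u
  have hrep : ∀ v : quotPiece I (a + 1) b, ∃ w ∈ biPiece k n m (a, b),
      v.1 = h • Ideal.Quotient.mk I w := fun v => by
    obtain ⟨r, hr, hrv⟩ := exists_rep v
    obtain ⟨w, hw, hrw⟩ := exists_sub_smul_mem hI hadm hr
    exact ⟨w, hw, by rw [← hrv, ← mk_smul]; exact Ideal.Quotient.eq.mpr hrw⟩
  have hTw : ∀ i (v : quotPiece I (a + 1) b) (w : BiRing k n m), w ∈ biPiece k n m (a, b) →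
      v.1 = h • Ideal.Quotient.mk I w →
      (T i v).1 = (X i : XRing k n) • Ideal.Quotient.mk I w := fun i v w hw hv => by
    have h1 : T i v = ⟨(X i : XRing k n) • Ideal.Quotient.mk I w,
        mk_mem_quotPiece (smul_mem_biPiece (isHomogeneous_X k i) hw)⟩ := by
      rw [hT, hv, smul_comm]
    rw [h1]
  have hcomm : ∀ i j, T i * T j = T j * T i := fun i j => by
    ext1 v
    obtain ⟨w, hw, hv⟩ := hrep v
    refine hbij.injective (Subtype.ext ?_)
    rw [Module.End.mul_apply, Module.End.mul_apply, coe_mulBar, coe_mulBar, (hT i _ _).mp rfl,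
      (hT j _ _).mp rfl, hTw j v w hw hv, hTw i v w hw hv, smul_comm]
  obtain ⟨ρ, hρ⟩ := exists_aeval_of_commute (F := k) T hcomm
  -- induction on `d`, splitting off one variable of `f` and one factor `h` at a time
  have key : ∀ (d c : ℕ) (f : XRing k n) (w : BiRing k n m) (v : quotPiece I (a + 1) b),
      c + d = a + 1 → f.IsHomogeneous d → w ∈ biPiece k n m (c, b) →
        (v : BiRing k n m ⧸ I) = Ideal.Quotient.mk I (h ^ d • w) →
          (ρ f v : BiRing k n m ⧸ I) = Ideal.Quotient.mk I (f • w) := by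
    intro d
    induction d with
    | zero =>
      intro c f w v hcd hf hw hv
      rw [← totalDegree_zero_iff_isHomogeneous, totalDegree_eq_zero_iff_eq_C] at hf
      rw [hf, pow_zero, one_smul] at *
      rw [← algebraMap_eq, AlgHom.commutes, Module.algebraMap_end_apply, algebraMap_smul,
        Submodule.coe_smul, hv]
      rfl
    | succ d ih =>
      intro c f w v hcd hf hw hv
      refine isHomogeneous_succ_induction (p := fun f => (ρ f v : BiRing k n m ⧸ I) =
        Ideal.Quotient.mk I (f • w)) ?_ ?_ ?_ f hf
      · rw [map_zero, zero_smul, map_zero]; rfl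
      · intro f g hf hg
        rw [map_add, LinearMap.add_apply, Submodule.coe_add, hf, hg, add_smul, map_add]
      · intro i g hg
        rw [map_mul, Module.End.mul_apply, hρ, mul_smul, mk_smul]
        refine hTw i _ _ ?_ ?_
        · have := smul_mem_biPiece hg hw
          rwa [show c + d = a by omega] at this
        · rw [ih (c + 1) g (h • w) v (by omega) hg (smul_mem_biPiece hadm.isLinearForm hw)
            (by rw [hv, smul_smul, pow_succ]), ← mk_smul, smul_comm]
  refine ⟨ρ, ?_, key⟩
  ext v
  obtain ⟨w, hw, hv⟩ := hrep v
  rw [key 1 a h w v rfl hadm.isLinearForm hw (by rw [pow_one, mk_smul, hv]), mk_smul, ← hv]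
  rfl

/-- The retraction of `k[x, y]` onto `(R/I)_{a, b}`, which maps `f y ^ β`, for `β` of degree `b`, to
`ρ(f) [h ^ a y ^ β]`. It kills `I` because `I` is generated in bidegrees `≤ (a, b)`, where it
is multiplication by a power of `h`. -/
theorem exists_retraction (hadm : IsAdmissible I a b h)
    (ρ : XRing k n →ₐ[k] Module.End k (quotPiece I a b))
    (hρ : ∀ (d c : ℕ) (f : XRing k n) (w : BiRing k n m) (v : quotPiece I a b), c + d = a →
        f.IsHomogeneous d → w ∈ biPiece k n m (c, b) → (v : BiRing k n m ⧸ I) =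
          Ideal.Quotient.mk I (h ^ d • w) → (ρ f v : BiRing k n m ⧸ I) =
          Ideal.Quotient.mk I (f • w)) :
    ∃ φ : BiRing k n m →ₗ[k] quotPiece I a b,
      (∀ (f : XRing k n) (r : BiRing k n m), φ (f • r) = ρ f (φ r)) ∧
      (∀ r ∈ I, φ r = 0) ∧
      (∀ (c d : ℕ) (r : BiRing k n m), c + d = a → r ∈ biPiece k n m (c, b) →
        (φ r : BiRing k n m ⧸ I) = Ideal.Quotient.mk I (h ^ d • r)) := by
  classical
  have hmem : ∀ (c d : ℕ) (r : BiRing k n m), c + d = a → r ∈ biPiece k n m (c, b) →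
      Ideal.Quotient.mk I (h ^ d • r) ∈ quotPiece I a b := fun c d r hcd hr => by
    rw [← hcd]
    exact mk_mem_quotPiece (smul_mem_biPiece (hadm.pow_isHomogeneous d) hr)
  let u : (Fin (m + 1) →₀ ℕ) → quotPiece I a b := fun β =>
    if hβ : β.degree = b then ⟨Ideal.Quotient.mk I (h ^ a • yMonomial k n β),
      hmem 0 a _ (zero_add a) (hβ ▸ yMonomial_mem_biPiece β)⟩ else 0
  let φ : BiRing k n m →ₗ[k] quotPiece I a b := (basisMonomials _ k).constr k fun e =>
    ρ (monomial (Finsupp.sumFinsuppEquivProdFinsupp e).1 1)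
      (u (Finsupp.sumFinsuppEquivProdFinsupp e).2)
  have hmon : ∀ (f : XRing k n) β, φ (f • yMonomial k n β) = ρ f (u β) := fun f β => by
    induction f using MvPolynomial.induction_on' with
    | monomial α c =>
      have h1 : (monomial α c : XRing k n) • yMonomial k n β =
          c • (basisMonomials _ k (Finsupp.sumFinsuppEquivProdFinsupp.symm (α, β)) :
            BiRing k n m) := by
        rw [coe_basisMonomials]
        beta_reduce
        rw [monomial_eq_smul_yMonomial, Equiv.apply_symm_apply, ← smul_assoc,
          smul_monomial, smul_eq_mul, mul_one]
      rw [h1, map_smul, Module.Basis.constr_basis, Equiv.apply_symm_apply, ← LinearMap.smul_apply,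
        ← map_smul, smul_monomial, smul_eq_mul, mul_one]
    | add f g hf hg => rw [add_smul, map_add, map_add, LinearMap.add_apply, hf, hg]
  have hspan : ∀ {p : BiRing k n m → Prop}, (∀ f g, p f → p g → p (f + g)) →
      (∀ (f : XRing k n) β, p (f • yMonomial k n β)) → ∀ r, p r := fun hadd hsmul r => by
    induction r using MvPolynomial.induction_on' with
    | monomial e c => rw [monomial_eq_smul_yMonomial]; exact hsmul _ _
    | add f g hf hg => exact hadd _ _ hf hg
  have hsmul : ∀ (f : XRing k n) (r : BiRing k n m), φ (f • r) = ρ f (φ r) := fun f r => by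
    refine hspan (p := fun r => φ (f • r) = ρ f (φ r)) ?_ ?_ r
    · intro r s hr hs
      rw [smul_add, map_add, map_add, map_add, hr, hs]
    · intro g β
      rw [smul_smul, hmon, hmon, map_mul, Module.End.mul_apply]
  have hle : ∀ (c d : ℕ) (r : BiRing k n m), c + d = a → r ∈ biPiece k n m (c, b) →
        (φ r : BiRing k n m ⧸ I) = Ideal.Quotient.mk I (h ^ d • r) := fun c d r hcd hr => by
    refine biPiece_induction (p := fun r => (φ r : BiRing k n m ⧸ I) =
      Ideal.Quotient.mk I (h ^ d • r)) ?_ ?_ ?_ r hr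
    · rw [map_zero, smul_zero, map_zero]; rfl
    · intro r s hr hs
      rw [map_add, Submodule.coe_add, hr, hs, smul_add, map_add]
    · intro f β hf hβ
      rw [hmon, smul_comm]
      refine hρ c d f (h ^ d • yMonomial k n β) (u β) (by omega) hf ?_ ?_
      · have := smul_mem_biPiece (hadm.pow_isHomogeneous d)
          (yMonomial_mem_biPiece (k := k) (n := n) β)
        rwa [zero_add, hβ] at this
      · simp only [u, dif_pos hβ]
        rw [smul_smul, ← pow_add, hcd]
  have hne : ∀ (c d : ℕ) (r : BiRing k n m), d ≠ b → r ∈ biPiece k n m (c, d) → φ r = 0 :=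
    fun c d r hd hr => by
    refine biPiece_induction (p := fun r => φ r = 0) (map_zero _) ?_ ?_ r hr
    · intro r s hr hs
      rw [map_add, hr, hs, add_zero]
    · intro f β hf hβ
      rw [hmon]
      simp only [u]
      rw [dif_neg (by rw [hβ]; exact hd), map_zero]
  refine ⟨φ, hsmul, fun r hr => ?_, hle⟩
  obtain ⟨G, hG, rfl⟩ := hadm.generated
  -- `I` is generated as an ideal of `k[x, y]`, so multiples by all `q` have to be considered
  suffices hall : ∀ q : BiRing k n m, φ (q * r) = 0 by simpa using hall 1
  induction hr using Submodule.span_induction with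
  | mem g hg =>
    obtain ⟨⟨c, d⟩, hcd, hgd⟩ := hG g hg
    refine hspan (p := fun q => φ (q * g) = 0) ?_ ?_
    · intro q q' hq hq'
      rw [add_mul, map_add, hq, hq', add_zero]
    · intro f β
      have h1 : yMonomial k n β * g ∈ biPiece k n m (c, β.degree + d) := by
        have := (yMonomial_mem_biPiece (k := k) (n := n) β).mul hgd
        rwa [Prod.mk_add_mk, zero_add] at this
      rw [smul_mul_assoc, hsmul]
      by_cases hb : β.degree + d = b
      · rw [hb] at h1
        have h2 : φ (yMonomial k n β * g) = 0 := by
          refine Subtype.ext ((hle c (a - c) _ (Nat.add_sub_cancel' hcd.1) h1).trans ?_)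
          rw [mk_smul, Ideal.Quotient.eq_zero_iff_mem.mpr
            (Ideal.mul_mem_left _ _ (Ideal.subset_span hg)), smul_zero]
          rfl
        rw [h2, map_zero]
      · rw [hne _ _ _ hb h1, map_zero]
  | zero => intro q; rw [mul_zero, map_zero]
  | add x y _ _ hx hy => intro q; rw [mul_add, map_add, hx, hy, add_zero]
  | smul c x _ hx => intro q; rw [smul_eq_mul, ← mul_assoc]; exact hx _

end Operators

end BihomElim

/-! ### Comparison of the row module with the graded extension -/

namespace BihomElim

open MvPolynomial

variable {k : Type*} [Field k] {n m : ℕ}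

theorem rowModule_fg (I : Ideal (BiRing k n m)) (b : ℕ) : (rowModule I b).FG := by
  have hspan : rowModule I b =
      Submodule.span (XRing k n) (quotPiece I 0 b : Set (BiRing k n m ⧸ I)) := by
    refine le_antisymm (Submodule.span_le.mpr (Set.iUnion_subset fun a => ?_))
      (Submodule.span_mono (Set.subset_iUnion
        (fun a => (quotPiece I a b : Set (BiRing k n m ⧸ I))) 0))
    rintro _ ⟨r, hr, rfl⟩
    refine biPiece_induction (p := fun r => Ideal.Quotient.mk I r ∈
      Submodule.span (XRing k n) (quotPiece I 0 b : Set (BiRing k n m ⧸ I))) ?_ ?_ ?_ r hr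
    · rw [map_zero]
      exact Submodule.zero_mem _
    · intro f g hf hg
      rw [map_add]
      exact Submodule.add_mem _ hf hg
    · intro f β _ hβ
      rw [mk_smul]
      exact Submodule.smul_mem _ _ (Submodule.subset_span
        (mk_mem_quotPiece (hβ ▸ yMonomial_mem_biPiece β)))
  have hfin : (quotPiece I 0 b).FG := Module.Finite.iff_fg.mp inferInstance
  obtain ⟨t, ht⟩ := hfin
  exact ⟨t, by rw [hspan, ← ht, Submodule.span_span_of_tower]⟩

theorem mk_mem_rowModule {I : Ideal (BiRing k n m)} {c b : ℕ} {r : BiRing k n m}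
    (hr : r ∈ biPiece k n m (c, b)) : Ideal.Quotient.mk I r ∈ rowModule I b :=
  Submodule.subset_span (Set.mem_iUnion.mpr ⟨c, mk_mem_quotPiece hr⟩)

theorem mem_rowAnnihilator_iff {I : Ideal (BiRing k n m)} {b : ℕ} {f : XRing k n} :
    f ∈ rowAnnihilator I b ↔ ∀ q ∈ rowModule I b, f • q = 0 := by
  rw [rowAnnihilator, Module.mem_annihilator]
  exact ⟨fun hf q hq => congrArg Subtype.val (hf ⟨q, hq⟩), fun hf q => Subtype.ext (hf q q.2)⟩

/-- Elements of the row module are represented by polynomials of degree `b` in `y`. -/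
theorem exists_rep_of_mem_rowModule {I : Ideal (BiRing k n m)} {b : ℕ} {q : BiRing k n m ⧸ I}
    (hq : q ∈ rowModule I b) : ∃ r, Ideal.Quotient.mk I r = q ∧
      ∀ c d, d ≠ b → weightedHomogeneousComponent (biWeight n m) (c, d) r = 0 := by
  induction hq using Submodule.span_induction with
  | mem q hq =>
    obtain ⟨c, r, hr, hrq⟩ := Set.mem_iUnion.mp hq
    refine ⟨r, hrq, fun c' d hd => ?_⟩
    exact IsWeightedHomogeneous.weightedHomogeneousComponent_ne (c', d) hr
      fun hcd => hd (congrArg Prod.snd hcd)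
  | zero => exact ⟨0, map_zero _, fun _ _ _ => map_zero _⟩
  | add x y _ _ hx hy =>
    obtain ⟨r, rfl, hr⟩ := hx
    obtain ⟨s, rfl, hs⟩ := hy
    exact ⟨r + s, map_add _ _ _, fun c d hd => by rw [map_add, hr c d hd, hs c d hd, add_zero]⟩
  | smul f x _ hx =>
    obtain ⟨r, rfl, hr⟩ := hx
    refine ⟨f • r, mk_smul f r, ?_⟩
    clear * - hr
    induction f using MvPolynomial.induction_on with
    | C a =>
      intro c d hd
      rw [← algebraMap_eq, algebraMap_smul, map_smul, hr c d hd, smul_zero]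
    | add f g hf hg =>
      intro c d hd
      rw [add_smul, map_add, hf c d hd, hg c d hd, add_zero]
    | mul_X f i hf =>
      intro c d hd
      rw [mul_comm, mul_smul]
      rcases c with - | c
      · exact component_zero_smul (isHomogeneous_X k i) d _
      · rw [component_succ_smul (isHomogeneous_X k i), hf c d hd, smul_zero]

section Retraction

variable {I : Ideal (BiRing k n m)} {a b : ℕ} {h : XRing k n}
  {W : Type*} [AddCommGroup W] [Module (XRing k n) W]

/-- The map `R/I → W[t]` whose coefficient at `t ^ d` is the retraction of the component of
bidegree `(d, b)`. -/
theorem exists_gradedExt_map (hI : IsBihomogeneous I) (φ : BiRing k n m →ₗ[XRing k n] W)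
    (hφI : ∀ r ∈ I, φ r = 0) (b : ℕ) :
    ∃ Φ : (BiRing k n m ⧸ I) →ₗ[XRing k n] GradedExt k (Fin (n + 1)) W,
      ∀ r d, (Φ (Ideal.Quotient.mk I r)).coeff k _ d =
        φ (weightedHomogeneousComponent (biWeight n m) (d, b) r) := by
  have hsupp : ∀ r : BiRing k n m, (Function.support fun d : ℕ =>
      φ (weightedHomogeneousComponent (biWeight n m) (d, b) r)).Finite := fun r => by
    have h1 : Function.Injective fun d : ℕ => (d, b) := fun d d' hd => congrArg Prod.fst hd
    refine ((weightedHomogeneousComponent_finsupp (w := biWeight n m) (φ := r)).preimage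
      h1.injOn).subset fun d hd h0 => hd ?_
    change φ ((fun m_1 => weightedHomogeneousComponent (biWeight n m) m_1 r) (d, b)) = 0
    rw [h0, map_zero]
  let Φ₁ : BiRing k n m → GradedExt k (Fin (n + 1)) W := fun r =>
    PolynomialModule.ofCoeff _ (Finsupp.ofSupportFinite _ (hsupp r))
  have hΦ₁ : ∀ r d, (Φ₁ r).coeff k _ d =
      φ (weightedHomogeneousComponent (biWeight n m) (d, b) r) := fun r d => rfl
  have hadd : ∀ r s, Φ₁ (r + s) = Φ₁ r + Φ₁ s := fun r s =>
    GradedExt.ext_coeff fun d => by rw [hΦ₁, GradedExt.coeff_add, hΦ₁, hΦ₁, map_add, map_add]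
  have hX : ∀ (i : Fin (n + 1)) r, Φ₁ ((X i : XRing k n) • r) = (X i : XRing k n) • Φ₁ r :=
    fun i r => GradedExt.ext_coeff fun d => by
      rw [hΦ₁, GradedExt.coeff_smul_of_isHomogeneous (isHomogeneous_X k i)]
      rcases d with - | d
      · rw [component_zero_smul (isHomogeneous_X k i), map_zero, if_neg (by omega)]
      · rw [component_succ_smul (isHomogeneous_X k i), map_smul, if_pos (by omega),
          Nat.add_sub_cancel, hΦ₁]
  have hsmul : ∀ (f : XRing k n) r, Φ₁ (f • r) = f • Φ₁ r := fun f r => by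
    induction f using MvPolynomial.induction_on with
    | C c =>
      refine GradedExt.ext_coeff fun d => ?_
      rw [hΦ₁, GradedExt.coeff_smul_of_isHomogeneous (isHomogeneous_C _ c), if_pos (Nat.zero_le d),
        Nat.sub_zero, hΦ₁, ← map_smul, ← algebraMap_eq, algebraMap_smul, algebraMap_smul, map_smul]
    | add f g hf hg => rw [add_smul, hadd, hf, hg, add_smul]
    | mul_X f i hf => rw [mul_comm, mul_smul, hX, hf, mul_smul]
  -- descend to `R/I`, which is the quotient of `R` by the kernel of `π`
  let Φ₀ : BiRing k n m →ₗ[XRing k n] GradedExt k (Fin (n + 1)) W :=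
    { toFun := Φ₁, map_add' := hadd, map_smul' := hsmul }
  let π : BiRing k n m →ₗ[XRing k n] (BiRing k n m ⧸ I) :=
    (Ideal.Quotient.mkₐ (XRing k n) I).toLinearMap
  have hπ : Function.Surjective π := Ideal.Quotient.mk_surjective
  have hker : LinearMap.ker π ≤ LinearMap.ker Φ₀ := fun r hr => by
    have hrI : r ∈ I := Ideal.Quotient.eq_zero_iff_mem.mp hr
    exact GradedExt.ext_coeff fun d => (hΦ₁ r d).trans (hφI _ (component_mem hI hrI _))
  refine ⟨(LinearMap.ker π).liftQ Φ₀ hker ∘ₗ (π.quotKerEquivOfSurjective hπ).symm.toLinearMap,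
    fun r d => ?_⟩
  have h1 := LinearMap.quotKerEquivOfSurjective_symm_apply π hπ r
  have h2 : ((LinearMap.ker π).liftQ Φ₀ hker ∘ₗ
      (π.quotKerEquivOfSurjective hπ).symm.toLinearMap) (π r) = Φ₀ r := by
    rw [LinearMap.comp_apply, LinearEquiv.coe_coe, h1, Submodule.liftQ_apply]
  exact (congrArg (fun y => GradedExt.coeff k _ y d) h2).trans (hΦ₁ r d)

variable {φ : BiRing k n m →ₗ[XRing k n] W}
  {Φ : (BiRing k n m ⧸ I) →ₗ[XRing k n] GradedExt k (Fin (n + 1)) W}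

/-- The kernel of the map from the row module to `W[t]` is killed by `h ^ a`. -/
theorem pow_smul_eq_zero_of_map_eq_zero (hI : IsBihomogeneous I) (hadm : IsAdmissible I a b h)
    (hφI : ∀ r ∈ I, φ r = 0) (hW : ∀ w : W, h • w = w)
    (hφ0 : ∀ (c d : ℕ) (r : BiRing k n m), c + d = a → r ∈ biPiece k n m (c, b) → φ r = 0 →
      h ^ d • r ∈ I)
    (hΦ : ∀ r d, (Φ (Ideal.Quotient.mk I r)).coeff k _ d =
        φ (weightedHomogeneousComponent (biWeight n m) (d, b) r))
    {q : BiRing k n m ⧸ I} (hq : q ∈ rowModule I b) (hq0 : Φ q = 0) : h ^ a • q = 0 := by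
  -- for `c ≤ a` this is the assumption on `φ`; for `c ≥ a`, modulo `I`, `r` is a multiple of
  -- `h ^ (c - a)`
  have hpiece : ∀ c r, r ∈ biPiece k n m (c, b) → φ r = 0 → h ^ a • r ∈ I := fun c r hr h0 => by
    rcases le_total c a with hca | hac
    · have h1 := hφ0 c (a - c) r (by omega) hr h0
      have h2 : h ^ a = h ^ c * h ^ (a - c) := by rw [← pow_add, Nat.add_sub_cancel' hca]
      rw [h2, mul_smul, smul_eq_mul_biRing]
      exact I.mul_mem_left _ h1
    · obtain ⟨j, rfl⟩ := Nat.exists_eq_add_of_le hac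
      obtain ⟨w, hw, hrw⟩ := exists_sub_pow_smul_mem hI hadm j hr
      have h1 : φ w = 0 := by
        have := hφI _ hrw
        rwa [map_sub, map_smul, pow_smul_eq_self (hW _), h0, zero_sub, neg_eq_zero] at this
      have h2 : w ∈ I := by simpa using hφ0 a 0 w rfl hw h1
      have h3 : r ∈ I := by
        have := I.add_mem hrw (I.mul_mem_left (algebraMap (XRing k n) _ (h ^ j)) h2)
        rwa [← smul_eq_mul_biRing, sub_add_cancel] at this
      rw [smul_eq_mul_biRing]
      exact I.mul_mem_left _ h3
  obtain ⟨r, rfl, hr⟩ := exists_rep_of_mem_rowModule hq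
  rw [← mk_smul, Ideal.Quotient.eq_zero_iff_mem,
    ← sum_weightedHomogeneousComponent (biWeight n m) r,
    finsum_eq_sum _ (weightedHomogeneousComponent_finsupp r), Finset.smul_sum]
  refine I.sum_mem fun e _ => ?_
  obtain ⟨c, d⟩ := e
  by_cases hd : d = b
  · subst hd
    refine hpiece c _ (weightedHomogeneousComponent_mem _ _ _) ?_
    rw [← hΦ, hq0, GradedExt.coeff_zero]
  · rw [hr c d hd, smul_zero]
    exact I.zero_mem

/-- The image of the row module in `W[t]` contains `t ^ a W[t]`. -/
theorem exists_map_eq_single (hW : ∀ w : W, h • w = w) (hadm : IsAdmissible I a b h)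
    (hφs : ∀ w : W, ∃ r ∈ biPiece k n m (a, b), φ r = w)
    (hΦ : ∀ r d, (Φ (Ideal.Quotient.mk I r)).coeff k _ d =
        φ (weightedHomogeneousComponent (biWeight n m) (d, b) r)) (d : ℕ) (w : W) :
    ∃ q ∈ rowModule I b, Φ q = GradedExt.single k _ (a + d) w := by
  obtain ⟨r, hr, rfl⟩ := hφs w
  have h1 := smul_mem_biPiece (hadm.pow_isHomogeneous d) hr
  refine ⟨_, mk_mem_rowModule h1, GradedExt.ext_coeff fun e => ?_⟩
  classical
  rw [hΦ, weightedHomogeneousComponent_of_mem h1, GradedExt.coeff_single]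
  by_cases he : a + d = e
  · subst he
    rw [if_pos rfl, if_pos rfl, map_smul, pow_smul_eq_self (hW _)]
  · rw [if_neg he, if_neg fun h2 => he (congrArg Prod.fst h2).symm, map_zero]

theorem exists_map_eq_pow_smul (hW : ∀ w : W, h • w = w) (hadm : IsAdmissible I a b h)
    (hφs : ∀ w : W, ∃ r ∈ biPiece k n m (a, b), φ r = w)
    (hΦ : ∀ r d, (Φ (Ideal.Quotient.mk I r)).coeff k _ d =
        φ (weightedHomogeneousComponent (biWeight n m) (d, b) r))
    (y : GradedExt k (Fin (n + 1)) W) : ∃ q ∈ rowModule I b, Φ q = h ^ a • y := by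
  induction y using GradedExt.induction_single with
  | zero => exact ⟨0, Submodule.zero_mem _, by rw [map_zero, smul_zero]⟩
  | add x y hx hy =>
    obtain ⟨q, hq, hqx⟩ := hx
    obtain ⟨s, hs, hsy⟩ := hy
    exact ⟨q + s, Submodule.add_mem _ hq hs, by rw [map_add, hqx, hsy, smul_add]⟩
  | single d w =>
    obtain ⟨q, hq, hqw⟩ := exists_map_eq_single hW hadm hφs hΦ d (h ^ a • w)
    exact ⟨q, hq, by rw [hqw, GradedExt.smul_single_of_isHomogeneous (hadm.pow_isHomogeneous a)]⟩

/-- `J_b` is contained in the largest homogeneous ideal inside `Ann W`. -/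
theorem homogeneousComponent_mem_annihilator (hW : ∀ w : W, h • w = w)
    (hadm : IsAdmissible I a b h) (hφs : ∀ w : W, ∃ r ∈ biPiece k n m (a, b), φ r = w)
    (hΦ : ∀ r d, (Φ (Ideal.Quotient.mk I r)).coeff k _ d =
        φ (weightedHomogeneousComponent (biWeight n m) (d, b) r))
    {f : XRing k n} (hf : f ∈ rowAnnihilator I b) (d : ℕ) :
    homogeneousComponent d f ∈ Module.annihilator (XRing k n) W := by
  refine Module.mem_annihilator.mpr fun w => ?_
  obtain ⟨q, hq, hqw⟩ := exists_map_eq_single hW hadm hφs hΦ 0 w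
  have h1 := GradedExt.coeff_smul_single f (a + 0) w (a + d)
  rw [← hqw, ← map_smul, mem_rowAnnihilator_iff.mp hf q hq, map_zero, GradedExt.coeff_zero,
    if_pos (by omega), add_zero, Nat.add_sub_cancel_left] at h1
  exact h1.symm

/-- Conversely, homogeneous elements of `Ann W` lie in `J_b` after multiplication by `h ^ a`. -/
theorem pow_mul_mem_rowAnnihilator
    (hker : ∀ q ∈ rowModule I b, Φ q = 0 → h ^ a • q = 0) {g : XRing k n} {e : ℕ}
    (hg : g.IsHomogeneous e) (hgW : g ∈ Module.annihilator (XRing k n) W) :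
    h ^ a * g ∈ rowAnnihilator I b := by
  rw [mem_rowAnnihilator_iff]
  intro q hq
  rw [mul_smul]
  refine hker _ (Submodule.smul_mem _ g hq) ?_
  rw [map_smul]
  refine GradedExt.ext_coeff fun d => ?_
  rw [GradedExt.coeff_smul_of_isHomogeneous hg, GradedExt.coeff_zero,
    Module.mem_annihilator.mp hgW, ite_self]

end Retraction

section Projection

variable {I : Ideal (BiRing k n m)} {a b : ℕ} {h : XRing k n} {K : Type*} [Field K] [Algebra k K]

/-- `h` does not vanish on `π_b(V(I))`: as `x_i ^ a` maps `M_b` into `h M_b`, the determinant trick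
produces elements of `J_b` which are monic in `x_i ^ a` modulo `h`. -/
theorem aeval_rep_ne_zero (hI : IsBihomogeneous I) (hadm : IsAdmissible I a b h)
    {ξ : ℙ K (Fin (n + 1) → K)} (hξ : ξ ∈ projB K I b) : aeval ξ.rep h ≠ 0 := by
  intro h0
  refine ξ.rep_nonzero (funext fun i => ?_)
  have : Module.Finite (XRing k n) (rowModule I b) := Module.Finite.iff_fg.mpr (rowModule_fg I b)
  set s : XRing k n := X i ^ a with hs
  have hsh : s.IsHomogeneous a := by simpa using (isHomogeneous_X k i).pow a
  have hrange : ∀ q ∈ rowModule I b, ∃ z ∈ rowModule I b, s • q = h • z := fun q hq => by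
    induction hq using Submodule.span_induction with
    | mem q hq =>
      obtain ⟨c, r, hr, hrq⟩ := Set.mem_iUnion.mp hq
      have h1 := smul_mem_biPiece hsh hr
      obtain ⟨w, hw, hrw⟩ : ∃ w, Ideal.Quotient.mk I w ∈ rowModule I b ∧ s • r - h • w ∈ I := by
        rcases c with - | c
        · rw [zero_add] at h1
          rcases a with - | a
          · refine ⟨0, by rw [map_zero]; exact Submodule.zero_mem _, ?_⟩
            rw [smul_zero, sub_zero]
            exact mem_of_mem_biPiece_zero hI hadm h1
          · obtain ⟨w, hw, hrw⟩ := exists_sub_smul_mem hI hadm h1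
            exact ⟨w, mk_mem_rowModule hw, hrw⟩
        · obtain ⟨w, hw, hrw⟩ := exists_sub_smul_mem_of_le hI hadm c (r := s • r)
            (by rwa [show a + c + 1 = c + 1 + a by omega])
          exact ⟨w, mk_mem_rowModule hw, hrw⟩
      refine ⟨_, hw, ?_⟩
      rw [← mk_smul, ← Ideal.Quotient.eq.mpr hrw, mk_smul, ← hrq]
      rfl
    | zero => exact ⟨0, Submodule.zero_mem _, by rw [smul_zero, smul_zero]⟩
    | add x y _ _ hx hy =>
      obtain ⟨z, hz, hxz⟩ := hx
      obtain ⟨z', hz', hyz⟩ := hy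
      exact ⟨z + z', Submodule.add_mem _ hz hz', by rw [smul_add, smul_add, hxz, hyz]⟩
    | smul f x _ hx =>
      obtain ⟨z, hz, hxz⟩ := hx
      exact ⟨f • z, Submodule.smul_mem _ f hz, by rw [smul_comm, hxz, smul_comm]⟩
  obtain ⟨p, hp, -, hpc, hp0⟩ :=
    LinearMap.exists_monic_and_natDegree_eq_and_coeff_mem_pow_and_aeval_eq_zero (XRing k n)
      (algebraMap (XRing k n) (Module.End (XRing k n) (rowModule I b)) s) (Ideal.span {h}) (by
        rintro _ ⟨⟨q, hq⟩, rfl⟩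
        obtain ⟨z, hz, hqz⟩ := hrange q hq
        have h1 : algebraMap (XRing k n) (Module.End (XRing k n) (rowModule I b)) s ⟨q, hq⟩ =
            h • (⟨z, hz⟩ : rowModule I b) := Subtype.ext hqz
        rw [h1]
        exact Submodule.smul_mem_smul (Ideal.mem_span_singleton_self h) Submodule.mem_top)
  rw [Polynomial.aeval_algebraMap_apply] at hp0
  have hmem : Polynomial.aeval s p ∈ rowAnnihilator I b :=
    Module.mem_annihilator.mpr fun q => by
      have := LinearMap.congr_fun hp0 q
      rwa [Module.algebraMap_end_apply] at this
  have h1 := hξ _ hmem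
  -- modulo `h` only the leading term of `p` survives
  have hmap : p.map (aeval (R := k) ξ.rep : XRing k n →ₐ[k] K).toRingHom =
      Polynomial.X ^ p.natDegree := by
    ext j
    rw [Polynomial.coeff_map, Polynomial.coeff_X_pow]
    rcases lt_trichotomy j p.natDegree with hj | rfl | hj
    · rw [if_neg hj.ne]
      obtain ⟨g, hg⟩ := Ideal.mem_span_singleton'.mp
        (Ideal.pow_le_self (Nat.sub_ne_zero_of_lt hj) (hpc j))
      rw [← hg]
      change aeval ξ.rep (g * h) = 0
      rw [map_mul, h0, mul_zero]
    · rw [if_pos rfl, hp.coeff_natDegree, map_one]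
    · rw [if_neg hj.ne', Polynomial.coeff_eq_zero_of_natDegree_lt hj, map_zero]
  have h2 : (aeval (R := k) ξ.rep : XRing k n →ₐ[k] K).toRingHom (p.eval s) = 0 := h1
  rw [← Polynomial.eval_map_apply, hmap, Polynomial.eval_pow, Polynomial.eval_X] at h2
  have h3 : ((ξ.rep i) ^ a) ^ p.natDegree = 0 := by
    have : (aeval (R := k) ξ.rep : XRing k n →ₐ[k] K).toRingHom s = (ξ.rep i) ^ a := by
      change aeval ξ.rep s = _
      rw [hs, map_pow, aeval_X]
    rwa [this] at h2
  exact eq_zero_of_pow_eq_zero (eq_zero_of_pow_eq_zero h3)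

end Projection

end BihomElim

/-! ### Points in affine coordinates -/

namespace BihomElim

open MvPolynomial

section AffinePoint

variable {k : Type*} [Field k] {K : Type*} [Field K] [Algebra k K]

theorem aeval_smul_of_isHomogeneous {ι : Type*} {g : MvPolynomial ι k} {d : ℕ}
    (hg : g.IsHomogeneous d) (c : K) (v : ι → K) : aeval (c • v) g = c ^ d * aeval v g := by
  rw [aeval_def, aeval_def, eval₂_eq, eval₂_eq, Finset.mul_sum]
  refine Finset.sum_congr rfl fun e he => ?_
  have hd : ∑ i ∈ e.support, e i = d := by
    rw [← hg (mem_support_iff.mp he), Finsupp.weight_apply, Finsupp.sum]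
    simp
  simp only [Pi.smul_apply, smul_eq_mul, mul_pow, Finset.prod_mul_distrib,
    Finset.prod_pow_eq_pow_sum, hd]
  ring

variable {n : ℕ} {h : XRing k n}

/-- The homogeneous coordinates of `ξ` at which the linear form `h` takes the value `1` (zero, if
`h` vanishes at `ξ`). -/
noncomputable def affinePoint (h : XRing k n) (ξ : ℙ K (Fin (n + 1) → K)) : Fin (n + 1) → K :=
  (aeval ξ.rep h)⁻¹ • ξ.rep

theorem aeval_affinePoint_self (hh : h.IsHomogeneous 1) {ξ : ℙ K (Fin (n + 1) → K)}
    (hξ : aeval ξ.rep h ≠ 0) : aeval (affinePoint h ξ) h = 1 := by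
  rw [affinePoint, aeval_smul_of_isHomogeneous hh, pow_one, inv_mul_cancel₀ hξ]

theorem affinePoint_mk (hh : h.IsHomogeneous 1) (v : Fin (n + 1) → K) (hv : v ≠ 0) :
    affinePoint h (Projectivization.mk K v hv) = (aeval v h)⁻¹ • v := by
  obtain ⟨c, hc⟩ := Projectivization.exists_smul_eq_mk_rep K v hv
  rw [affinePoint, ← hc, Units.smul_def, aeval_smul_of_isHomogeneous hh, pow_one, mul_inv,
    smul_smul, mul_comm (c : K)⁻¹, mul_assoc, inv_mul_cancel₀ c.ne_zero, mul_one]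

theorem affinePoint_ne_zero {ξ : ℙ K (Fin (n + 1) → K)} (hξ : aeval ξ.rep h ≠ 0) :
    affinePoint h ξ ≠ 0 :=
  smul_ne_zero (inv_ne_zero hξ) ξ.rep_nonzero

theorem mk_affinePoint {ξ : ℙ K (Fin (n + 1) → K)} (hξ : aeval ξ.rep h ≠ 0) :
    Projectivization.mk K (affinePoint h ξ) (affinePoint_ne_zero hξ) = ξ :=
  ((Projectivization.mk_eq_mk_iff' K _ _ _ ξ.rep_nonzero).mpr ⟨_, rfl⟩).trans ξ.mk_rep

theorem isSeparable_affinePoint (hh : h.IsHomogeneous 1) {ξ : ℙ K (Fin (n + 1) → K)}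
    (hξ : IsSeparablePoint k ξ) (i : Fin (n + 1)) : IsSeparable k (affinePoint h ξ i) := by
  obtain ⟨v, hv, rfl, hsep⟩ := hξ
  rw [affinePoint_mk hh]
  exact Field.isSeparable_mul (Field.isSeparable_inv (isSeparable_aeval hsep h)) (hsep i)

theorem mem_pointIdeal_iff_affinePoint {ξ : ℙ K (Fin (n + 1) → K)} (hξ : aeval ξ.rep h ≠ 0)
    (f : XRing k n) : f ∈ pointIdeal k ξ ↔ aeval
      (fun i => Polynomial.C (affinePoint h ξ i) * Polynomial.X : Fin (n + 1) → Polynomial K) f =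
        0 := by
  rw [pointIdeal, RingHom.mem_ker, aeval_C_mul_X_eq_zero_iff, aeval_C_mul_X_eq_zero_iff]
  refine forall_congr' fun d => ?_
  rw [affinePoint, aeval_smul_of_isHomogeneous (homogeneousComponent_isHomogeneous d f),
    mul_eq_zero, or_iff_right (pow_ne_zero _ (inv_ne_zero hξ))]

theorem fracEval_eq_aeval_affinePoint {ξ : ℙ K (Fin (n + 1) → K)} (hξ : aeval ξ.rep h ≠ 0)
    {g' : FracRing h} {j : ℕ} {g : XRing k n} (hg : g.IsHomogeneous j) (hg' : IsFraction g' g j) :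
    fracEval g' ξ = aeval (affinePoint h ξ) g := by
  rw [IsFraction, g'.eq_num_div_den, Localization.mk_eq_mk_iff, Localization.r_iff_exists] at hg'
  obtain ⟨⟨_, e, rfl⟩, he⟩ := hg'
  obtain ⟨l, hl⟩ := g'.den_mem
  have hl' : aeval ξ.rep g'.den = aeval ξ.rep h ^ l := by rw [← map_pow]; exact congrArg _ hl.symm
  have h1 := congrArg (aeval (R := k) ξ.rep) he
  simp only [map_mul, map_pow, hl'] at h1
  have h2 := mul_left_cancel₀ (pow_ne_zero e hξ) h1
  rw [fracEval, affinePoint, aeval_smul_of_isHomogeneous hg, hl', inv_pow, ← div_eq_inv_mul,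
    div_eq_div_iff (pow_ne_zero _ hξ) (pow_ne_zero _ hξ), mul_comm, h2, mul_comm]

end AffinePoint

section Points

variable {k : Type*} [Field k] {n m : ℕ} {I : Ideal (BiRing k n m)} {a b : ℕ} {h : XRing k n}
  {K : Type*} [Field K] [Algebra k K] {W : Type*} [AddCommGroup W] [Module (XRing k n) W]

theorem mk_mem_projB (hJ : ∀ f ∈ rowAnnihilator I b, ∀ d,
      homogeneousComponent d f ∈ Module.annihilator (XRing k n) W) {v : Fin (n + 1) → K}
    (hv : v ≠ 0) (hvW : ∀ f ∈ Module.annihilator (XRing k n) W, aeval v f = 0) :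
    Projectivization.mk K v hv ∈ projB K I b := by
  intro f hf
  obtain ⟨c, hc⟩ := Projectivization.exists_smul_eq_mk_rep K v hv
  rw [← hc, ← sum_homogeneousComponent f, map_sum]
  refine Finset.sum_eq_zero fun d _ => ?_
  rw [Units.smul_def, aeval_smul_of_isHomogeneous (homogeneousComponent_isHomogeneous d f),
    hvW _ (hJ f hf d), mul_zero]

/-- A point of `π_b(V(I))`, normalized by `h = 1`, is a zero of `Ann W`: elements of `Ann W` can be
homogenized by means of `h`. -/
theorem aeval_affinePoint_eq_zero (hh : h.IsHomogeneous 1) (hW : ∀ w : W, h • w = w)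
    (hJ : ∀ (g : XRing k n) (e : ℕ), g.IsHomogeneous e →
      g ∈ Module.annihilator (XRing k n) W → h ^ a * g ∈ rowAnnihilator I b)
    {ξ : ℙ K (Fin (n + 1) → K)} (hξ : ξ ∈ projB K I b) (hξh : aeval ξ.rep h ≠ 0)
    {f : XRing k n} (hf : f ∈ Module.annihilator (XRing k n) W) :
    aeval (affinePoint h ξ) f = 0 := by
  obtain ⟨d, g, hg, q, hq⟩ := exists_isHomogeneous_sub_dvd hh f
  have hgW : g ∈ Module.annihilator (XRing k n) W := Module.mem_annihilator.mpr fun w => by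
    rw [← sub_add_cancel g f, hq, add_smul, Module.mem_annihilator.mp hf, mul_comm, mul_smul,
      sub_smul, hW, one_smul, sub_self, smul_zero, add_zero]
  have h1 := hξ _ (hJ g d hg hgW)
  rw [map_mul, map_pow] at h1
  have h2 := (mul_eq_zero.mp h1).resolve_left (pow_ne_zero _ hξh)
  have h3 : aeval (affinePoint h ξ) (g - f) = 0 := by
    rw [hq, map_mul, map_sub, aeval_affinePoint_self hh hξh, map_one, sub_self, zero_mul]
  rw [map_sub, affinePoint, aeval_smul_of_isHomogeneous hg, h2, mul_zero, zero_sub,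
    neg_eq_zero] at h3
  exact h3

end Points

end BihomElim

open BihomElim in
theorem mainTheorem2 {k K : Type*} [Field k] [Field K] [Algebra k K] [IsAlgClosure k K]
    {n m : ℕ} (I : Ideal (BiRing k n m)) (hI : IsBihomogeneous I) (a b : ℕ) (h : XRing k n)
    (hadm : IsAdmissible I a b h) :
    ∃ (hfin : (projB K I b).Finite)
      (hinv : ∀ j : ℕ, Function.Bijective (mulBar I a b (hadm.pow_isHomogeneous j)))
      (μ : ℙ K (Fin (n + 1) → K) → ℕ),
      (∀ ξ ∈ projB K I b, MvPolynomial.aeval ξ.rep h ≠ 0) ∧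
      (∀ ξ ∈ projB K I b, 0 < μ ξ) ∧
      (∀ (g' : FracRing h) (j : ℕ) (g : XRing k n) (hg : g.IsHomogeneous j), IsFraction g' g j →
        (fracMul I a b (hadm.pow_isHomogeneous j) (hinv j) hg).charpoly.map (algebraMap k K) =
          ∏ ξ ∈ hfin.toFinset, (Polynomial.X - Polynomial.C (fracEval g' ξ)) ^ μ ξ) ∧
      (∀ ξ ∈ projB K I b, IsSeparablePoint k ξ →
        Module.length (Localization.AtPrime (pointIdeal k ξ))
          (LocalizedModule (pointIdeal k ξ).primeCompl (rowModule I b)) = (μ ξ : ℕ∞)) := by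
  classical
  have : IsAlgClosed K := IsAlgClosure.isAlgClosed k
  have hh := hadm.isLinearForm
  obtain ⟨ρ, hρh, hρ⟩ := exists_operators hI hadm
  obtain ⟨φ₀, hφ₀s, hφI, hφ₀⟩ := exists_retraction hadm ρ hρ
  -- `quotPiece I a b` carries no `k[x]`-module structure of its own; let `x_i` act as `h⁻¹ x_i`
  let _ : Module (XRing k n) (quotPiece I a b) := Module.compHom _ ρ.toRingHom
  have hact : ∀ (f : XRing k n) (v : quotPiece I a b), f • v = ρ f v := fun f v => rfl
  have : IsScalarTower k (XRing k n) (quotPiece I a b) := ⟨fun c f v => by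
    rw [hact, hact, map_smul, LinearMap.smul_apply]⟩
  let φ : BiRing k n m →ₗ[XRing k n] quotPiece I a b :=
    { toFun := φ₀, map_add' := map_add φ₀, map_smul' := hφ₀s }
  have hW : ∀ v : quotPiece I a b, h • v = v := fun v => by
    rw [hact, hρh, Module.End.one_apply]
  have hφrep : ∀ r ∈ biPiece k n m (a, b), (φ r : BiRing k n m ⧸ I) = Ideal.Quotient.mk I r :=
    fun r hr => (hφ₀ a 0 r rfl hr).trans (by rw [pow_zero, one_smul])
  have hφ0 : ∀ (c d : ℕ) (r : BiRing k n m), c + d = a → r ∈ biPiece k n m (c, b) → φ r = 0 →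
      h ^ d • r ∈ I := fun c d r hcd hr h0 => by
    rw [← Ideal.Quotient.eq_zero_iff_mem, ← hφ₀ c d r hcd hr]
    exact congrArg Subtype.val h0
  have hφs : ∀ v : quotPiece I a b, ∃ r ∈ biPiece k n m (a, b), φ r = v := fun v => by
    obtain ⟨r, hr, hrv⟩ := exists_rep v
    exact ⟨r, hr, Subtype.ext ((hφrep r hr).trans hrv)⟩
  have hinv : ∀ j : ℕ, Function.Bijective (mulBar I a b (hadm.pow_isHomogeneous j)) := fun j => by
    refine ⟨(injective_iff_map_eq_zero _).mpr fun v hv => ?_, mulBar_pow_surjective hI hadm j⟩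
    obtain ⟨r, hr, rfl⟩ := hφs v
    have h1 : h ^ j • r ∈ I := by
      rw [← Ideal.Quotient.eq_zero_iff_mem, mk_smul, ← hφrep r hr, ← coe_mulBar
        (hadm.pow_isHomogeneous j), hv]
      rfl
    have h2 : φ (h ^ j • r) = 0 := hφI _ h1
    rwa [map_smul, pow_smul_eq_self (hW _)] at h2
  have hfrac : ∀ (j : ℕ) (g : XRing k n) (hg : g.IsHomogeneous j),
      fracMul I a b (hadm.pow_isHomogeneous j) (hinv j) hg =
        Algebra.lsmul k k (quotPiece I a b) g := fun j g hg => by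
    refine LinearMap.ext fun v => ?_
    obtain ⟨r, hr, rfl⟩ := hφs v
    obtain ⟨w, hw, hrw⟩ := exists_sub_pow_smul_mem hI hadm j (smul_mem_biPiece hg hr)
    have h1 : φ (g • r) = φ w := by
      have h2 : φ (g • r - h ^ j • w) = 0 := hφI _ hrw
      rwa [map_sub, map_smul _ (h ^ j), pow_smul_eq_self (hW _), sub_eq_zero] at h2
    have h2 : Algebra.lsmul k k (quotPiece I a b) g (φ r) = φ w := (map_smul φ g r).symm.trans h1
    rw [fracMul_apply_eq_iff, h2, hφrep w hw, hφrep r hr,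
      ← mk_smul, ← mk_smul]
    exact (Ideal.Quotient.eq.mpr hrw).symm
  -- comparison of the row module with `V[t]`, where `V = (R/I)_{a, b}`
  obtain ⟨Φ, hΦ⟩ := exists_gradedExt_map hI φ hφI b
  have hker : ∀ q ∈ rowModule I b, Φ q = 0 → h ^ a • q = 0 := fun q hq hq0 =>
    pow_smul_eq_zero_of_map_eq_zero hI hadm hφI hW hφ0 hΦ hq hq0
  have hne : ∀ ξ ∈ projB K I b, MvPolynomial.aeval ξ.rep h ≠ 0 := fun ξ hξ =>
    aeval_rep_ne_zero hI hadm hξ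
  -- the points of `π_b(V(I))` correspond to the joint eigenvalues through `affinePoint h`
  obtain ⟨s, hs⟩ := exists_isPointMultiset (K := K) hh (quotPiece I a b) hW
  have hmem : ∀ ξ ∈ projB K I b, affinePoint h ξ ∈ s := fun ξ hξ =>
    (hs.mem_iff _).mpr fun f hf => aeval_affinePoint_eq_zero hh hW
      (fun g e hg hgW => pow_mul_mem_rowAnnihilator hker hg hgW) hξ (hne ξ hξ) hf
  have hs1 : ∀ v ∈ s, MvPolynomial.aeval v h = 1 := fun v hv => by
    have := (hs.mem_iff v).mp hv (h - 1) (Module.mem_annihilator.mpr fun w => by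
      rw [sub_smul, hW, one_smul, sub_self])
    rwa [map_sub, map_one, sub_eq_zero] at this
  have hs0 : ∀ v ∈ s, v ≠ 0 := fun v hv h0 => by
    have h1 := aeval_smul_of_isHomogeneous hh (0 : K) v
    rw [zero_smul, ← h0, hs1 v hv, pow_one, zero_mul] at h1
    exact one_ne_zero h1
  have hmk : ∀ v (hv : v ∈ s), Projectivization.mk K v (hs0 v hv) ∈ projB K I b := fun v hv =>
    mk_mem_projB (fun f hf d => homogeneousComponent_mem_annihilator hW hadm hφs hΦ hf d)
      (hs0 v hv) ((hs.mem_iff v).mp hv)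
  have hfin : (projB K I b).Finite := by
    refine Set.Finite.of_finite_image (f := affinePoint h)
      (s.toFinset.finite_toSet.subset ?_) ?_
    · rintro _ ⟨ξ, hξ, rfl⟩
      exact Multiset.mem_toFinset.mpr (hmem ξ hξ)
    · intro ξ hξ ζ hζ hξζ
      rw [← mk_affinePoint (hne ξ hξ), ← mk_affinePoint (hne ζ hζ)]
      congr
  refine ⟨hfin, hinv, fun ξ => s.count (affinePoint h ξ), hne,
    fun ξ hξ => Multiset.count_pos.mpr (hmem ξ hξ), fun g' j g hg hg' => ?_, fun ξ hξ hsep => ?_⟩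
  · rw [hfrac, hs.charpoly_map, Finset.prod_multiset_map_count]
    symm
    refine Finset.prod_bij (fun ξ _ => affinePoint h ξ) ?_ ?_ ?_ ?_
    · exact fun ξ hξ => Multiset.mem_toFinset.mpr (hmem ξ (hfin.mem_toFinset.mp hξ))
    · intro ξ hξ ζ hζ hξζ
      rw [← mk_affinePoint (hne ξ (hfin.mem_toFinset.mp hξ)),
        ← mk_affinePoint (hne ζ (hfin.mem_toFinset.mp hζ))]
      congr
    · intro v hv
      rw [Multiset.mem_toFinset] at hv
      exact ⟨_, hfin.mem_toFinset.mpr (hmk v hv), by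
        rw [affinePoint_mk hh, hs1 v hv, inv_one, one_smul]⟩
    · intro ξ hξ
      rw [fracEval_eq_aeval_affinePoint (hne ξ (hfin.mem_toFinset.mp hξ)) hg hg']
  · have hhp : h ∈ (pointIdeal k ξ).primeCompl := fun hmem =>
      hne ξ hξ ((mem_pointIdeal_iff k ξ hh).mp hmem)
    replace hhp := Submonoid.pow_mem _ hhp a
    rw [← hs.length_eq _ (isSeparable_affinePoint hh hsep) (aeval_affinePoint_self hh (hne ξ hξ))
      (pointIdeal k ξ) (mem_pointIdeal_iff_affinePoint (hne ξ hξ))]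
    refine length_localizedModule_eq_of_torsion _ (Φ.domRestrict (rowModule I b)) ?_ ?_
    · rintro ⟨q, hq⟩ hq0
      exact ⟨h ^ a, hhp, Subtype.ext (hker q hq hq0)⟩
    · intro y
      obtain ⟨q, hq, hqy⟩ := exists_map_eq_pow_smul hW hadm hφs hΦ y
      exact ⟨h ^ a, hhp, ⟨q, hq⟩, hqy⟩
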